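/- Let $\mathbb F$ be an algebraically closed field of characteristic zero. Let $\mathfrak g=\mathfrak g_0\oplus\mathfrak g_1$ be a finite-dimensional quasireductive Lie superalgebra over $\mathbb F$, i.e. $\mathfrak g_0$ is a reductive Lie algebra and $\mathfrak g$ is semisimple as a $\mathfrak g_0$-module. All modules are $\mathbb Z/2$-graded, submodules are graded, and isomorphisms preserve parity; $\Pi$ denotes change of parity. Let $\mathcal F(\mathfrak g)$ be the category of finite-dimensional $\mathfrak g$-modules that are semisimple over $\mathfrak g_0$. Fix a Cartan subalgebra $\mathfrak h_0$ of $\mathfrak g_0$ and let $\mathfrak h$ be the centralizer of $\mathfrak h_0$ in $\mathfrak g$. For a $\mathfrak g$-module $M$ and $\mu\in\mathfrak h_0^*$ put $M_\mu=\{m\in M : hm=\mu(h)m \text{ for all } h\in\mathfrak h_0\}$ and $\mathcal P(M)=\{\mu\in\mathfrak h_0^* : M_\mu\neq 0\}$. Each $M_\mu$ is an $\mathfrak h$-module. Let $\Delta\subset\mathfrak h_0^*$ be the set of nonzero $\alpha$ such that $\mathfrak g_\alpha\neq 0$ (for the adjoint action), and let $Q\subset\mathfrak h_0^*$ be the additive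 subgroup generated by $\Delta$. Let $\gamma:Q\to\mathbb R$ be a homomorphism of abelian groups with $\gamma(\alpha)\neq 0$ for all $\alpha\in\Delta$, and let $\Delta^+=\{\alpha\in\Delta : \gamma(\alpha)>0\}$ (the set of roots of the Borel subalgebra $\mathfrak b=\mathfrak h\oplus\bigoplus_{\alpha\in\Delta^+}\mathfrak g_\alpha$ defined by $\gamma$). For $\mu,\lambda\in\mathfrak h_0^*$ write $\mu\le\lambda$ if $\lambda=\mu+\sum_{\alpha\in\Delta^+}m_\alpha\alpha$ with $m_\alpha\in\mathbb Z_{\ge 0}$. **Theorem.** Let $L\in\mathcal F(\mathfrak g)$ be simple. There exists a unique weight $\lambda\in\mathcal P(L)$, called the highest weight of $L$, such that $\mu\le\lambda$ for all $\mu\in\mathcal P(L)$. Furthermore, $L_\lambda$ is a simple $\mathfrak h$-module. If two simple modules $L,M\in\mathcal F(\mathfrak g)$ have the same highest weight, then $M$ is isomorphic to $L$ or to $\Pi(L)$. -/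

import Mathlib

/-- A vector superspace structure on `V`: a decomposition `V = V₀ ⊕ V₁`. -/
structure Superspace (F V : Type*) [Field F] [AddCommGroup V] [Module F V] where
  /-- The homogeneous parts `V₀` (even) and `V₁` (odd). -/
  part : ZMod 2 → Submodule F V
  isCompl : IsCompl (part 0) (part 1)

/-- The sign `(-1) ^ (p(a) p(b))` for elements `a`, `b` of parities `i`, `j`. -/
def superSign (F : Type*) [Field F] (i j : ZMod 2) : F := (-1) ^ (i.val * j.val)

namespace Superspace

variable {F V : Type*} [Field F] [AddCommGroup V] [Module F V]

/-- A subspace `N` is graded if `N = (N ∩ V₀) + (N ∩ V₁)`. -/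
def IsGraded (S : Superspace F V) (N : Submodule F V) : Prop :=
  N ≤ (N ⊓ S.part 0) ⊔ (N ⊓ S.part 1)

/-- The superspace structure induced on a graded subspace. -/
def sub (S : Superspace F V) (N : Submodule F V) (hN : S.IsGraded N) : Superspace F N where
  part i := (S.part i).comap N.subtype
  isCompl := by
    constructor
    · rw [Submodule.disjoint_def]
      rintro ⟨x, hx⟩ h0 h1
      exact Subtype.ext (Submodule.disjoint_def.1 S.isCompl.disjoint x h0 h1)
    · rw [codisjoint_iff, eq_top_iff]
      rintro ⟨x, hx⟩ -
      obtain ⟨a, ha, b, hb, rfl⟩ := Submodule.mem_sup.1 (hN hx)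
      exact Submodule.mem_sup.2 ⟨⟨a, ha.1⟩, ha.2, ⟨b, hb.1⟩, hb.2, rfl⟩

/-- The opposite grading. -/
def shift (S : Superspace F V) : Superspace F V where
  part i := S.part (i + 1)
  isCompl := by
    have h : (1 + 1 : ZMod 2) = 0 := by decide
    rw [zero_add, h]
    exact S.isCompl.symm

/-- A common eigenspace of a family of even operators is graded. -/
theorem isGraded_of_even {ι : Type*} (S : Superspace F V) (T : ι → V →ₗ[F] V) (c : ι → F)
    (hT : ∀ k i, ∀ v ∈ S.part i, T k v ∈ S.part i) (N : Submodule F V)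
    (hN : ∀ v, v ∈ N ↔ ∀ k, T k v = c k • v) : S.IsGraded N := by
  intro v hv
  have htop : v ∈ S.part 0 ⊔ S.part 1 := by rw [S.isCompl.sup_eq_top]; trivial
  obtain ⟨a, ha, b, hb, rfl⟩ := Submodule.mem_sup.1 htop
  have key : ∀ k, T k a - c k • a = 0 ∧ T k b - c k • b = 0 := by
    intro k
    have h := (hN _).1 hv k
    have ha' := (S.part 0).sub_mem (hT k 0 a ha) ((S.part 0).smul_mem (c k) ha)
    have hb' := (S.part 1).sub_mem (hT k 1 b hb) ((S.part 1).smul_mem (c k) hb)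
    have hab : T k a - c k • a = -(T k b - c k • b) := by
      rw [map_add, smul_add] at h
      rw [← sub_eq_zero] at h ⊢
      rw [← h]; abel
    have h0 := Submodule.disjoint_def.1 S.isCompl.disjoint _ ha'
      (hab ▸ (S.part 1).neg_mem hb')
    refine ⟨h0, ?_⟩
    rw [h0] at hab
    exact neg_eq_zero.1 hab.symm
  exact Submodule.mem_sup.2 ⟨a, ⟨(hN a).2 fun k => sub_eq_zero.1 (key k).1, ha⟩,
    b, ⟨(hN b).2 fun k => sub_eq_zero.1 (key k).2, hb⟩, rfl⟩

end Superspace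

/-- A Lie superalgebra structure on the vector space `𝔤`. -/
structure LieSuperalgebra (F 𝔤 : Type*) [Field F] [AddCommGroup 𝔤] [Module F 𝔤] extends
    Superspace F 𝔤 where
  bracket : 𝔤 →ₗ[F] 𝔤 →ₗ[F] 𝔤
  bracket_mem : ∀ i j, ∀ a ∈ part i, ∀ b ∈ part j, bracket a b ∈ part (i + j)
  skew : ∀ i j, ∀ a ∈ part i, ∀ b ∈ part j, bracket a b = -(superSign F i j • bracket b a)
  jacobi : ∀ i j, ∀ a ∈ part i, ∀ b ∈ part j, ∀ c,
    bracket a (bracket b c) = bracket (bracket a b) c + superSign F i j • bracket b (bracket a c)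

/-- A (left, `ℤ/2`-graded) module over the Lie superalgebra `G`, with underlying space `V`. -/
structure SuperModule {F 𝔤 : Type*} [Field F] [AddCommGroup 𝔤] [Module F 𝔤]
    (G : LieSuperalgebra F 𝔤) (V : Type*) [AddCommGroup V] [Module F V] extends
    Superspace F V where
  act : 𝔤 →ₗ[F] V →ₗ[F] V
  act_mem : ∀ i j, ∀ a ∈ G.part i, ∀ v ∈ part j, act a v ∈ part (i + j)
  act_bracket : ∀ i j, ∀ a ∈ G.part i, ∀ b ∈ G.part j, ∀ v,
    act (G.bracket a b) v = act a (act b v) - superSign F i j • act b (act a v)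

/-- A (graded) subalgebra of a Lie superalgebra. -/
structure SubSuperalgebra {F 𝔤 : Type*} [Field F] [AddCommGroup 𝔤] [Module F 𝔤]
    (G : LieSuperalgebra F 𝔤) where
  carrier : Submodule F 𝔤
  isGraded : G.IsGraded carrier
  bracket_mem : ∀ a ∈ carrier, ∀ b ∈ carrier, G.bracket a b ∈ carrier

section

variable {F 𝔤 : Type*} [Field F] [AddCommGroup 𝔤] [Module F 𝔤] {G : LieSuperalgebra F 𝔤}

/-- A subalgebra, as a Lie superalgebra in its own right. -/
def SubSuperalgebra.toLieSuperalgebra (S : SubSuperalgebra G) :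
    LieSuperalgebra F S.carrier where
  toSuperspace := G.toSuperspace.sub S.carrier S.isGraded
  bracket := LinearMap.mk₂ F (fun a b => ⟨G.bracket a b, S.bracket_mem a a.2 b b.2⟩)
    (by intros; ext; simp) (by intros; ext; simp) (by intros; ext; simp) (by intros; ext; simp)
  bracket_mem i j a ha b hb := G.bracket_mem i j a ha b hb
  skew i j a ha b hb := Subtype.ext (G.skew i j a ha b hb)
  jacobi i j a ha b hb c := Subtype.ext (G.jacobi i j a ha b hb c)

namespace SuperModule

variable {V W : Type*} [AddCommGroup V] [Module F V] [AddCommGroup W] [Module F W]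

/-- Restriction of a module to a subalgebra. -/
def restrict (M : SuperModule G V) (S : SubSuperalgebra G) :
    SuperModule S.toLieSuperalgebra V where
  toSuperspace := M.toSuperspace
  act := M.act ∘ₗ S.carrier.subtype
  act_mem i j a ha v hv := M.act_mem i j a ha v hv
  act_bracket i j a ha b hb v := M.act_bracket i j a ha b hb v

/-- `N` is a (graded) submodule of `M`. -/
def IsSubmodule (M : SuperModule G V) (N : Submodule F V) : Prop :=
  M.IsGraded N ∧ ∀ a, ∀ v ∈ N, M.act a v ∈ N

/-- A submodule, as a module in its own right. -/
def sub (M : SuperModule G V) (N : Submodule F V) (hN : M.IsSubmodule N) :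
    SuperModule G N where
  toSuperspace := M.toSuperspace.sub N hN.1
  act := LinearMap.mk₂ F (fun a v => ⟨M.act a v, hN.2 a v v.2⟩)
    (by intros; ext; simp) (by intros; ext; simp) (by intros; ext; simp) (by intros; ext; simp)
  act_mem i j a ha v hv := M.act_mem i j a ha v hv
  act_bracket i j a ha b hb v := Subtype.ext (M.act_bracket i j a ha b hb v)

/-- Simple module: nonzero, without proper nonzero (graded) submodules. -/
def IsSimple (M : SuperModule G V) : Prop :=
  Nontrivial V ∧ ∀ N, M.IsSubmodule N → N = ⊥ ∨ N = ⊤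

/-- Semisimple module: every (graded) submodule has a complementary (graded) submodule. -/
def IsSemisimple (M : SuperModule G V) : Prop :=
  ∀ N, M.IsSubmodule N → ∃ N', M.IsSubmodule N' ∧ IsCompl N N'

/-- The module `Π(M)` obtained from `M` by changing the parity. -/
def parityChange (M : SuperModule G V) : SuperModule G V where
  toSuperspace := M.toSuperspace.shift
  act := M.act
  act_mem i j a ha v hv := by
    have h := M.act_mem i (j + 1) a ha v hv
    rwa [← add_assoc] at h
  act_bracket := M.act_bracket

/-- Isomorphisms of modules (parity preserving). -/
structure Iso (M : SuperModule G V) (N : SuperModule G W) where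
  toEquiv : V ≃ₗ[F] W
  map_part : ∀ i, ∀ v ∈ M.part i, toEquiv v ∈ N.part i
  map_act : ∀ a v, toEquiv (M.act a v) = N.act a (toEquiv v)

end SuperModule

namespace LieSuperalgebra

variable (G)

/-- The adjoint module. -/
def adjoint : SuperModule G 𝔤 where
  toSuperspace := G.toSuperspace
  act := G.bracket
  act_mem := G.bracket_mem
  act_bracket i j a ha b hb c := by rw [G.jacobi i j a ha b hb c]; abel

/-- The even part `𝔤₀`. -/
def even : Submodule F 𝔤 := G.part 0

/-- The even part is an ordinary Lie algebra. -/
instance [CharZero F] : LieRing G.even where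
  bracket a b := ⟨G.bracket a b, by simpa using! G.bracket_mem 0 0 a a.2 b b.2⟩
  add_lie a b c := Subtype.ext (by simp)
  lie_add a b c := Subtype.ext (by simp)
  lie_self a := Subtype.ext (by
    have h := G.skew 0 0 a a.2 a a.2
    have h1 : superSign F 0 0 = 1 := by simp [superSign]
    rw [h1, one_smul] at h
    have h2 : (2 : F) • G.bracket (a : 𝔤) (a : 𝔤) = 0 := by
      rw [two_smul]
      exact add_eq_zero_iff_eq_neg.2 h
    exact (smul_eq_zero.1 h2).resolve_left two_ne_zero)
  leibniz_lie a b c := Subtype.ext (by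
    have h := G.jacobi 0 0 a a.2 b b.2 c
    have h1 : superSign F 0 0 = 1 := by simp [superSign]
    rw [h1, one_smul] at h
    exact h)

instance [CharZero F] : LieAlgebra F G.even where
  lie_smul t a b := Subtype.ext (by
    change G.bracket (a : 𝔤) (t • (b : 𝔤)) = t • G.bracket (a : 𝔤) (b : 𝔤)
    simp)

/-- The even part `𝔤₀`, as a subalgebra of the Lie superalgebra `𝔤`. -/
def evenSubalgebra : SubSuperalgebra G where
  carrier := G.even
  isGraded := fun _ hx => Submodule.mem_sup_left ⟨hx, hx⟩
  bracket_mem a ha b hb := by simpa using! G.bracket_mem 0 0 a ha b hb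

/-- Quasireductive: `𝔤₀` is reductive (its radical is its center) and `𝔤` is a semisimple
`𝔤₀`-module. -/
def IsQuasireductive [CharZero F] : Prop :=
  LieAlgebra.HasCentralRadical F G.even ∧ (G.adjoint.restrict G.evenSubalgebra).IsSemisimple

end LieSuperalgebra

/-- Membership in the category `𝓕(𝔤)`: finite-dimensional modules, semisimple over `𝔤₀`. -/
def SuperModule.InF {V : Type*} [AddCommGroup V] [Module F V] (M : SuperModule G V) : Prop :=
  FiniteDimensional F V ∧ (M.restrict G.evenSubalgebra).IsSemisimple

section Weights

variable [CharZero F] (H : LieSubalgebra F G.even)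

namespace SuperModule

variable {V : Type*} [AddCommGroup V] [Module F V] (M : SuperModule G V)

/-- The weight space `M_μ`, for `μ ∈ 𝔥₀^*`. Here and below `H` plays the role of `𝔥₀`. -/
def weightSpace (μ : Module.Dual F H) : Submodule F V where
  carrier := {v | ∀ h : H, M.act ((h : G.even) : 𝔤) v = μ h • v}
  add_mem' hv hw h := by rw [map_add, hv h, hw h, smul_add]
  zero_mem' h := by rw [map_zero, smul_zero]
  smul_mem' c v hv h := by rw [map_smul, hv h, smul_comm]

/-- The set `P(M)` of weights of `M`. -/
def weights : Set (Module.Dual F H) := {μ | M.weightSpace H μ ≠ ⊥}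

theorem isGraded_weightSpace (μ : Module.Dual F H) : M.IsGraded (M.weightSpace H μ) :=
  M.toSuperspace.isGraded_of_even (fun h : H => M.act ((h : G.even) : 𝔤)) (fun h => μ h)
    (fun h i v hv => by
      simpa using M.act_mem 0 i ((h : G.even) : 𝔤) (h : G.even).2 v hv) _ (fun _ => Iff.rfl)

end SuperModule

namespace LieSuperalgebra

/-- The Cartan subalgebra `𝔥` of `𝔤`: the centralizer of `𝔥₀` in `𝔤`. -/
def cartan : SubSuperalgebra G where
  carrier :=
    { carrier := {x | ∀ h : H, G.bracket ((h : G.even) : 𝔤) x = 0}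
      add_mem' := fun hv hw h => by rw [map_add, hv h, hw h, add_zero]
      zero_mem' := fun h => map_zero _
      smul_mem' := fun c v hv h => by rw [map_smul, hv h, smul_zero] }
  isGraded :=
    G.toSuperspace.isGraded_of_even (fun h : H => G.bracket ((h : G.even) : 𝔤)) (fun _ => 0)
      (fun h i v hv => by
        simpa using G.bracket_mem 0 i ((h : G.even) : 𝔤) (h : G.even).2 v hv) _
      (fun v => by simp only [zero_smul]; rfl)
  bracket_mem a ha b hb h := by
    have htop : a ∈ G.part 0 ⊔ G.part 1 := by rw [G.isCompl.sup_eq_top]; trivial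
    obtain ⟨a₀, h₀, a₁, h₁, rfl⟩ := Submodule.mem_sup.1 htop
    have hh : ((h : G.even) : 𝔤) ∈ G.part 0 := (h : G.even).2
    have e0 := G.jacobi 0 0 _ hh a₀ h₀ b
    have e1 := G.jacobi 0 1 _ hh a₁ h₁ b
    have s0 : superSign F 0 0 = 1 := by simp [superSign]
    have s1 : superSign F 0 1 = 1 := by simp [superSign]
    rw [hb h, map_zero, smul_zero, add_zero] at e0 e1
    rw [map_add, LinearMap.add_apply, map_add, e0, e1, ← LinearMap.add_apply, ← map_add,
      ← map_add, ha h, map_zero, LinearMap.zero_apply]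

/-- The set `Δ` of roots: nonzero `α ∈ 𝔥₀^*` with `𝔤_α ≠ 0`. -/
def roots : Set (Module.Dual F H) := {α | α ≠ 0 ∧ α ∈ G.adjoint.weights H}

/-- The subgroup `Q` of `𝔥₀^*` generated by `Δ`. -/
def rootLattice : AddSubgroup (Module.Dual F H) := AddSubgroup.closure (roots H)

/-- A root, as an element of `Q`. -/
def rootOf (α : roots H) : rootLattice H := ⟨α, AddSubgroup.subset_closure α.2⟩

/-- The set `Δ⁺` of roots that are positive with respect to `γ`. -/
def positiveRoots (γ : rootLattice H →+ ℝ) : Set (Module.Dual F H) :=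
  {α | ∃ hα : α ∈ roots H, 0 < γ (rootOf H ⟨α, hα⟩)}

/-- The order on `𝔥₀^*`: `μ ≤ lam` iff `lam = μ + ∑ m_α α` with `m_α ∈ ℤ_{≥ 0}`, `α ∈ Δ⁺`. -/
def WeightLE (γ : rootLattice H →+ ℝ) (μ lam : Module.Dual F H) : Prop :=
  ∃ m : Module.Dual F H →₀ ℕ, (∀ α ∈ m.support, α ∈ positiveRoots H γ) ∧
    lam = μ + m.sum fun α n => n • α

end LieSuperalgebra

namespace SuperModule

variable {V : Type*} [AddCommGroup V] [Module F V] (M : SuperModule G V)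

/-- `lam` is a weight of `M` such that `μ ≤ lam` for all weights `μ` of `M`. -/
def IsHighestWeight (γ : LieSuperalgebra.rootLattice H →+ ℝ) (lam : Module.Dual F H) : Prop :=
  lam ∈ M.weights H ∧ ∀ μ ∈ M.weights H, LieSuperalgebra.WeightLE H γ μ lam

/-- Weight spaces are stable under `𝔥`. -/
theorem isSubmodule_weightSpace (μ : Module.Dual F H) :
    (M.restrict (LieSuperalgebra.cartan H)).IsSubmodule (M.weightSpace H μ) := by
  refine ⟨M.isGraded_weightSpace H μ, ?_⟩
  rintro ⟨a, ha⟩ v hv h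
  change M.act ((h : G.even) : 𝔤) (M.act a v) = μ h • M.act a v
  have htop : a ∈ G.part 0 ⊔ G.part 1 := by rw [G.isCompl.sup_eq_top]; trivial
  obtain ⟨a₀, h₀, a₁, h₁, rfl⟩ := Submodule.mem_sup.1 htop
  have hh : ((h : G.even) : 𝔤) ∈ G.part 0 := (h : G.even).2
  have e0 := M.act_bracket 0 0 _ hh a₀ h₀ v
  have e1 := M.act_bracket 0 1 _ hh a₁ h₁ v
  have s0 : superSign F 0 0 = 1 := by simp [superSign]
  have s1 : superSign F 0 1 = 1 := by simp [superSign]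
  rw [s0, hv h, one_smul] at e0
  rw [s1, hv h, one_smul] at e1
  have e : M.act (G.bracket ((h : G.even) : 𝔤) (a₀ + a₁)) v = 0 := by
    rw [ha h, map_zero, LinearMap.zero_apply]
  rw [map_add, map_add, LinearMap.add_apply, e0, e1] at e
  rw [← sub_eq_zero, ← e]
  simp only [map_add, LinearMap.add_apply, map_smul, smul_add]
  abel

/-- The weight space `M_μ` as an `𝔥`-module. -/
def weightModule (μ : Module.Dual F H) :
    SuperModule (LieSuperalgebra.cartan H).toLieSuperalgebra (M.weightSpace H μ) :=
  (M.restrict (LieSuperalgebra.cartan H)).sub (M.weightSpace H μ) (M.isSubmodule_weightSpace H μ)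

end SuperModule

end Weights

end

/-! The proof has three stages.

Diagonalizability. Modulo its center, 𝔤₀ is semisimple, so root vectors of the quotient exist; a
complement of the center that is stable under 𝔤₀ lifts them to genuine eigenvectors of 𝔥₀. Hence 𝔤₀
is spanned by root vectors, and by semisimplicity over 𝔤₀ so is every object of 𝓕(𝔤) by weight
vectors, in particular 𝔤 itself.

Highest weights. If S is a graded 𝔥-stable space of vectors of weight `lam` killed by all positive
root vectors, then U(𝔫⁻)S is a submodule whose `lam`-weight space is S and whose other weights are
strictly lower (`isSubmodule_lowerSpan`, `lowerSpan_inf_weightSpace_le`). In a simple module it is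
everything as soon as S ≠ 0. This makes the maximal weight unique and L_λ simple over 𝔥.

Classification. The even part of 𝔥 is 𝔥₀ and acts on both highest weight spaces by the same scalars,
so the odd part of 𝔥 acts on the linear maps between them by anticommuting operators of square zero.
These have a nonzero homogeneous common kernel vector (`exists_isOddInvariant`): up to Π, a nonzero
𝔥-homomorphism f. Its graph is again a space S as above, now in the direct sum of the two modules,
and the submodule it generates is the graph of an isomorphism
(`nonempty_iso_of_isHom_weightModule`). -/

/-! ### Reductive Lie algebras: diagonalizability of a Cartan subalgebra. -/

section ReductiveLie

open LieAlgebra LieModule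

variable {F K : Type*} [Field F] [LieRing K] [LieAlgebra F K]

/-- The quotient of a reductive Lie algebra by its center has trivial radical. -/
theorem LieAlgebra.HasCentralRadical.hasTrivialRadical_quotient [FiniteDimensional F K]
    (hK : HasCentralRadical F K) :
    HasTrivialRadical F (K ⧸ center F K) := by
  rw [hasTrivialRadical_iff_no_abelian_ideals]
  intro J hJ
  set π := LieSubmodule.Quotient.mk' (center F K)
  let I : LieIdeal F K :=
    { J.toSubmodule.comap (π : K →ₗ[F] K ⧸ center F K) with
      lie_mem := fun {x m} hm => J.lie_mem (x := π x) hm }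
  have hI : ∀ x, x ∈ I ↔ π x ∈ J := fun x => Iff.rfl
  have h1 : ⁅I, I⁆ ≤ center F K := by
    rw [LieSubmodule.lieIdeal_oper_eq_span, LieSubmodule.lieSpan_le]
    rintro _ ⟨x, y, rfl⟩
    have h : ⁅(⟨π x, x.2⟩ : J), (⟨π y, y.2⟩ : J)⁆ = 0 := trivial_lie_zero _ _ _ _
    have h' : π ⁅(x : K), (y : K)⁆ = 0 := congrArg Subtype.val h
    exact (LieSubmodule.Quotient.mk_eq_zero _).1 h'
  have hs : IsSolvable I := by
    -- Since ⁅I, I⁆ is central, the second derived ideal ⁅⁅I, I⁆, ⁅I, I⁆⁆ already vanishes.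
    refine IsSolvable.mk (R := F) (k := 2) ((LieIdeal.derivedSeries_eq_bot_iff I 2).2 ?_)
    rw [derivedSeriesOfIdeal_succ, derivedSeriesOfIdeal_succ, derivedSeriesOfIdeal_zero,
      LieSubmodule.lie_eq_bot_iff]
    intro x hx y hy
    exact (mem_maxTrivSubmodule F K K y).1 (h1 hy) x
  have hle : I ≤ center F K := by
    rw [← hK.radical_eq_center]
    exact (LieIdeal.solvable_iff_le_radical F K I).1 hs
  rw [LieSubmodule.eq_bot_iff]
  intro y hy
  obtain ⟨x, rfl⟩ := LieSubmodule.Quotient.surjective_mk' (center F K) y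
  exact (LieSubmodule.Quotient.mk_eq_zero _).2 (hle ((hI x).2 hy))

/-- The image of a Cartan subalgebra under a surjective homomorphism with central kernel is a
Cartan subalgebra. -/
theorem LieSubalgebra.IsCartanSubalgebra.range_comp_incl {K' : Type*} [LieRing K']
    [LieAlgebra F K'] {H : LieSubalgebra F K} (hH : H.IsCartanSubalgebra) (f : K →ₗ⁅F⁆ K')
    (hf : Function.Surjective f) (hker : ∀ x, f x = 0 → x ∈ center F K) :
    (f.comp H.incl).range.IsCartanSubalgebra where
  nilpotent := (f.comp H.incl).isNilpotent_range
  self_normalizing := by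
    -- Central elements normalize H, hence lie in H. Relations that hold modulo the kernel of `f`
    -- can therefore be corrected inside H.
    have hz : ∀ x, f x = 0 → x ∈ H := by
      intro x hx
      rw [← hH.self_normalizing, LieSubalgebra.mem_normalizer_iff]
      intro y _
      rw [← lie_skew, (mem_maxTrivSubmodule F K K x).1 (hker x hx) y, neg_zero]
      exact H.zero_mem
    refine le_antisymm (fun y hy => ?_) (LieSubalgebra.le_normalizer _)
    obtain ⟨x, rfl⟩ := hf y
    refine ⟨⟨x, ?_⟩, rfl⟩
    rw [← hH.self_normalizing, LieSubalgebra.mem_normalizer_iff]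
    intro z hz'
    obtain ⟨w, hw⟩ := (LieSubalgebra.mem_normalizer_iff _ _).1 hy (f z) ⟨⟨z, hz'⟩, rfl⟩
    have h1 : ⁅x, z⁆ - (w : K) ∈ H := hz _ (by
      rw [map_sub, LieHom.map_lie, sub_eq_zero]
      exact hw.symm)
    simpa using H.add_mem h1 w.2

/-- Elements of a Cartan subalgebra of a reductive Lie algebra (whose center has a complementary
ideal) act diagonalizably in the adjoint representation. -/
theorem LieAlgebra.span_weight_vectors_eq_top [CharZero F] [FiniteDimensional F K]
    [IsAlgClosed F] (hK : HasCentralRadical F K)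
    (H : LieSubalgebra F K) (hH : H.IsCartanSubalgebra) (N : Submodule F K)
    (hN : ∀ x : K, ∀ y ∈ N, ⁅x, y⁆ ∈ N) (hc : IsCompl (center F K).toSubmodule N) :
    Submodule.span F {x : K | ∃ μ : Module.Dual F H, ∀ h : H, ⁅(h : K), x⁆ = μ h • x} = ⊤ := by
  set S := Submodule.span F {x : K | ∃ μ : Module.Dual F H, ∀ h : H, ⁅(h : K), x⁆ = μ h • x}
  let f : K →ₗ⁅F⁆ K ⧸ center F K :=
    { (LieSubmodule.Quotient.mk' (center F K) : K →ₗ[F] K ⧸ center F K) with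
      map_lie' := rfl }
  have hf : Function.Surjective f := LieSubmodule.Quotient.surjective_mk' (center F K)
  have hker : ∀ x, f x = 0 ↔ x ∈ center F K := fun x =>
    LieSubmodule.Quotient.mk_eq_zero (center F K)
  have hcent : ∀ x ∈ center F K, ∀ y : K, ⁅y, x⁆ = 0 := fun x hx =>
    (mem_maxTrivSubmodule F K K x).1 hx
  have := hK.hasTrivialRadical_quotient
  set H' := (f.comp H.incl).range
  have hH' : H'.IsCartanSubalgebra := hH.range_comp_incl f hf fun x hx => (hker x).1 hx
  have hZ : (center F K).toSubmodule ≤ S := fun x hx =>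
    Submodule.subset_span ⟨0, fun h => by
      rw [hcent x hx, LinearMap.zero_apply, zero_smul]⟩
  have key : ∀ χ : Weight F H' (K ⧸ center F K),
      (rootSpace H' χ).toSubmodule ≤ S.map (f : K →ₗ[F] K ⧸ center F K) := by
    intro χ y hy
    obtain ⟨x, rfl⟩ := hf y
    -- Lift the root vector into N. The failure of the lift to be an eigenvector is then both
    -- central and in N, hence zero.
    obtain ⟨z, hz, n, hn, rfl⟩ := Submodule.mem_sup.1
      (show x ∈ (center F K).toSubmodule ⊔ N by rw [hc.sup_eq_top]; trivial)
    have hfz : f z = 0 := (hker z).2 hz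
    rw [map_add, hfz, zero_add] at hy ⊢
    refine ⟨n, Submodule.subset_span ⟨χ.toLinear.comp ((f.comp H.incl).rangeRestrict : H →ₗ[F] H'),
      fun h => ?_⟩, rfl⟩
    have h1 := LieAlgebra.IsKilling.lie_eq_smul_of_mem_rootSpace hy ((f.comp H.incl).rangeRestrict h)
    have h2 : f (⁅(h : K), n⁆ - χ ((f.comp H.incl).rangeRestrict h) • n) = 0 := by
      rw [map_sub, map_smul, LieHom.map_lie, sub_eq_zero]
      exact h1
    exact sub_eq_zero.1 (Submodule.disjoint_def.1 hc.disjoint _ ((hker _).1 h2)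
      (N.sub_mem (hN _ _ hn) (N.smul_mem _ hn)))
  have htop : S.map (f : K →ₗ[F] K ⧸ center F K) = ⊤ := by
    rw [eq_top_iff]
    have h := congrArg LieSubmodule.toSubmodule
      (iSup_genWeightSpace_eq_top' F H' (K ⧸ center F K))
    rw [LieSubmodule.iSup_toSubmodule, LieSubmodule.top_toSubmodule] at h
    rw [← h]
    exact iSup_le key
  rw [eq_top_iff]
  intro x _
  obtain ⟨s, hs, hsx⟩ : f x ∈ S.map (f : K →ₗ[F] K ⧸ center F K) := htop ▸ trivial
  have h3 : x - s ∈ center F K := (hker _).1 (by rw [map_sub, sub_eq_zero]; exact hsx.symm)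
  simpa using S.add_mem (hZ h3) hs

end ReductiveLie

/-! ### Weight spaces of supermodules and weight space decompositions. -/

section SuperWeights

variable {F 𝔤 : Type*} [Field F] [AddCommGroup 𝔤] [Module F 𝔤] {G : LieSuperalgebra F 𝔤}
variable {V : Type*} [AddCommGroup V] [Module F V]

@[simp]
theorem superSign_zero_left (j : ZMod 2) : superSign F 0 j = 1 := by simp [superSign]

namespace Superspace

/-- Every vector is a sum of an even and an odd vector. -/
theorem exists_add (S : Superspace F V) (v : V) :
    ∃ a ∈ S.part 0, ∃ b ∈ S.part 1, a + b = v :=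
  Submodule.mem_sup.1 (show v ∈ S.part 0 ⊔ S.part 1 by rw [S.isCompl.sup_eq_top]; trivial)

/-- Additive predicates that hold for homogeneous vectors hold for all vectors. -/
theorem induction_homogeneous (S : Superspace F V) {p : V → Prop}
    (hom : ∀ i, ∀ v ∈ S.part i, p v) (add : ∀ v w, p v → p w → p (v + w)) (v : V) : p v := by
  obtain ⟨a, ha, b, hb, rfl⟩ := S.exists_add v
  exact add _ _ (hom 0 a ha) (hom 1 b hb)

theorem IsGraded.exists_add {S : Superspace F V} {N : Submodule F V} (hN : S.IsGraded N) {v : V}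
    (hv : v ∈ N) : ∃ a ∈ N, a ∈ S.part 0 ∧ ∃ b ∈ N, b ∈ S.part 1 ∧ a + b = v := by
  obtain ⟨a, ha, b, hb, h⟩ := Submodule.mem_sup.1 (hN hv)
  exact ⟨a, ha.1, ha.2, b, hb.1, hb.2, h⟩

theorem IsGraded.iSup {ι : Sort*} {S : Superspace F V} {N : ι → Submodule F V}
    (hN : ∀ i, S.IsGraded (N i)) : S.IsGraded (⨆ i, N i) :=
  iSup_le fun i => (hN i).trans
    (sup_le_sup (inf_le_inf_right _ (le_iSup N i)) (inf_le_inf_right _ (le_iSup N i)))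

end Superspace

namespace SuperModule

variable (M : SuperModule G V)

theorem act_bracket_even {a : 𝔤} (ha : a ∈ G.part 0) (b : 𝔤) (v : V) :
    M.act (G.bracket a b) v = M.act a (M.act b v) - M.act b (M.act a v) := by
  refine G.induction_homogeneous
    (p := fun b => M.act (G.bracket a b) v = M.act a (M.act b v) - M.act b (M.act a v))
    (fun j b hb => ?_) (fun b c hb hc => ?_) b
  · simpa using M.act_bracket 0 j a ha b hb v
  · simp only [map_add, LinearMap.add_apply, hb, hc]
    abel

variable [CharZero F] (H : LieSubalgebra F G.even)

/-- A module over a Lie superalgebra, as a module over the even part. -/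
abbrev lieRingModule : LieRingModule G.even V where
  bracket a v := M.act a v
  add_lie a b v := by
    change M.act ((a : 𝔤) + b) v = _
    rw [map_add]
    rfl
  lie_add a v w := map_add _ _ _
  leibniz_lie a b v := by
    change M.act a (M.act b v) = M.act (G.bracket a b) v + M.act b (M.act a v)
    rw [M.act_bracket_even a.2]
    abel

theorem lieModule : letI := M.lieRingModule; LieModule F G.even V := by
  let := M.lieRingModule
  exact
    { smul_lie := fun t a v => by
        change M.act (t • (a : 𝔤)) v = t • M.act a v
        rw [map_smul]
        rfl
      lie_smul := fun t a v => map_smul _ _ _ }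

theorem act_mem_weightSpace {α μ : Module.Dual F H} {a : 𝔤} {v : V}
    (ha : a ∈ G.adjoint.weightSpace H α) (hv : v ∈ M.weightSpace H μ) :
    M.act a v ∈ M.weightSpace H (α + μ) := by
  intro h
  have h1 := M.act_bracket_even (h : G.even).2 a v
  have h2 : G.bracket ((h : G.even) : 𝔤) a = α h • a := ha h
  rw [h2, hv h, map_smul, map_smul, LinearMap.smul_apply] at h1
  rw [LinearMap.add_apply, add_smul, h1]
  abel

/-- Weight spaces sit inside the generalized weight spaces of the nilpotent algebra H, which are
independent. -/
theorem iSupIndep_weightSpace (hH : LieRing.IsNilpotent H) :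
    iSupIndep (M.weightSpace H) := by
  let := M.lieRingModule
  have := M.lieModule
  have h := (LieSubmodule.iSupIndep_toSubmodule).2 (LieModule.iSupIndep_genWeightSpace F H V)
  refine (h.comp (f := fun μ : Module.Dual F H => (μ : H → F)) DFunLike.coe_injective).mono
    fun μ v hv => ?_
  exact LieModule.weightSpace_le_genWeightSpace V _ ((LieModule.mem_weightSpace _ _).2 hv)

theorem finite_weights [FiniteDimensional F V] (hH : LieRing.IsNilpotent H) :
    (M.weights H).Finite :=
  WellFoundedGT.finite_ne_bot_of_iSupIndep (M.iSupIndep_weightSpace H hH)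

/-- A nonzero `H`-stable subspace contains a common eigenvector. -/
theorem exists_mem_weightSpace [IsAlgClosed F] [FiniteDimensional F V]
    (hH : LieRing.IsNilpotent H) (N : Submodule F V)
    (hN : ∀ h : H, ∀ v ∈ N, M.act ((h : G.even) : 𝔤) v ∈ N) (hN0 : N ≠ ⊥) :
    ∃ μ, ∃ v ∈ N, v ≠ 0 ∧ v ∈ M.weightSpace H μ := by
  let := M.lieRingModule
  have := M.lieModule
  let N' : LieSubmodule F H V := { N with lie_mem := fun {h v} hv => hN h v hv }
  have : Nontrivial N' := Submodule.nontrivial_iff_ne_bot.2 hN0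
  obtain ⟨μ, hμ⟩ := LieModule.exists_nontrivial_weightSpace_of_isNilpotent F H N'
  obtain ⟨⟨⟨v, hvN⟩, hv⟩, hv0⟩ := exists_ne (0 : LieModule.weightSpace N' μ)
  refine ⟨μ, v, hvN, fun h => hv0 (Subtype.ext (Subtype.ext h)), fun h => ?_⟩
  exact congrArg Subtype.val ((LieModule.mem_weightSpace _ _).1 hv h)

/-- If `𝔤₀` is spanned by root vectors, then modules in `𝓕(𝔤)` are spanned by weight vectors. -/
theorem iSup_weightSpace_eq_top [IsAlgClosed F] (hH : LieRing.IsNilpotent H)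
    (hspan : G.even ≤ ⨆ α, G.even ⊓ G.adjoint.weightSpace H α) (hM : M.InF) :
    ⨆ μ, M.weightSpace H μ = ⊤ := by
  have := hM.1
  have hstab : ∀ a ∈ G.even, ∀ v ∈ ⨆ μ, M.weightSpace H μ,
      M.act a v ∈ ⨆ μ, M.weightSpace H μ := by
    intro a ha v hv
    have hx := hspan ha
    clear ha
    induction hx using Submodule.iSup_induction' with
    | mem α x hx =>
      induction hv using Submodule.iSup_induction' with
      | mem μ v hv => exact Submodule.mem_iSup_of_mem _ (M.act_mem_weightSpace H hx.2 hv)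
      | zero => rw [map_zero]; exact zero_mem _
      | add v w _ _ hv hw => rw [map_add]; exact add_mem hv hw
    | zero => rw [map_zero]; exact zero_mem _
    | add x y _ _ hx hy => rw [map_add]; exact add_mem hx hy
  -- The sum of the weight spaces is a 𝔤₀-submodule. A nonzero complement would contain a common
  -- eigenvector of H, which already lies in the sum.
  obtain ⟨N, hN, hc⟩ := hM.2 (⨆ μ, M.weightSpace H μ)
    ⟨Superspace.IsGraded.iSup fun μ => M.isGraded_weightSpace H μ, fun a v hv => hstab a a.2 v hv⟩
  suffices N = ⊥ by
    have h := hc.sup_eq_top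
    rwa [this, sup_bot_eq] at h
  by_contra hN0
  obtain ⟨μ, v, hvN, hv0, hv⟩ := M.exists_mem_weightSpace H hH N
    (fun h v hv => hN.2 ⟨_, (h : G.even).2⟩ v hv) hN0
  exact hv0 (Submodule.disjoint_def.1 hc.disjoint v (Submodule.mem_iSup_of_mem μ hv) hvN)

end SuperModule

namespace LieSuperalgebra

variable [CharZero F] (H : LieSubalgebra F G.even)

/-- In a quasireductive Lie superalgebra, the even part is spanned by root vectors. -/
theorem IsQuasireductive.even_le_iSup [IsAlgClosed F] [FiniteDimensional F 𝔤]
    (hG : G.IsQuasireductive) (hH : H.IsCartanSubalgebra) :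
    G.even ≤ ⨆ α, G.even ⊓ G.adjoint.weightSpace H α := by
  set Z : Submodule F 𝔤 := (LieAlgebra.center F G.even).toSubmodule.map G.even.subtype
  have hZe : Z ≤ G.even := Submodule.map_subtype_le _ _
  have hZ : (G.adjoint.restrict G.evenSubalgebra).IsSubmodule Z := by
    refine ⟨fun v hv => Submodule.mem_sup_left ⟨hv, hZe hv⟩, ?_⟩
    rintro a _ ⟨z, hz, rfl⟩
    have h := congrArg Subtype.val ((LieModule.mem_maxTrivSubmodule F G.even G.even z).1 hz a)
    change G.bracket a z ∈ Z
    rw [show G.bracket (a : 𝔤) (z : 𝔤) = 0 from h]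
    exact zero_mem _
  -- The complement of the center is found in 𝔤; as the center lies in 𝔤₀, intersecting with 𝔤₀
  -- leaves a complementary ideal there.
  obtain ⟨N, hN, hc⟩ := hG.2 Z hZ
  have hspan := LieAlgebra.span_weight_vectors_eq_top hG.1 H hH (N.comap G.even.subtype)
    (fun x y hy => hN.2 x y hy) (by
      constructor
      · rw [Submodule.disjoint_def]
        exact fun x hx hxN => Subtype.ext
          (Submodule.disjoint_def.1 hc.disjoint x ⟨x, hx, rfl⟩ hxN)
      · rw [codisjoint_iff, eq_top_iff]
        rintro x -
        obtain ⟨_, ⟨z, hz, rfl⟩, n, hn, h⟩ := Submodule.mem_sup.1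
          (show (x : 𝔤) ∈ Z ⊔ N by rw [hc.sup_eq_top]; trivial)
        refine Submodule.mem_sup.2 ⟨z, hz, x - z, ?_, by abel⟩
        rw [← eq_sub_iff_add_eq'] at h
        change (x : 𝔤) - z ∈ N
        exact h ▸ hn)
  intro x hx
  have h : (⟨x, hx⟩ : G.even) ∈ Submodule.span F
      {x : G.even | ∃ μ : Module.Dual F H, ∀ h : H, ⁅(h : G.even), x⁆ = μ h • x} :=
    hspan ▸ trivial
  have h' := Submodule.mem_map_of_mem (f := G.even.subtype) h
  rw [Submodule.map_span] at h'
  refine Submodule.span_le.2 ?_ h'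
  rintro _ ⟨y, ⟨μ, hμ⟩, rfl⟩
  exact Submodule.mem_iSup_of_mem μ ⟨y.2, fun h => congrArg Subtype.val (hμ h)⟩

theorem IsQuasireductive.iSup_weightSpace_eq_top [IsAlgClosed F] [FiniteDimensional F 𝔤]
    (hG : G.IsQuasireductive) (hH : H.IsCartanSubalgebra) (M : SuperModule G V) (hM : M.InF) :
    ⨆ μ, M.weightSpace H μ = ⊤ :=
  M.iSup_weightSpace_eq_top H hH.nilpotent (hG.even_le_iSup H hH) hM

/-- Quasireductivity puts the adjoint module in 𝓕(𝔤). -/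
theorem IsQuasireductive.iSup_rootSpace_eq_top [IsAlgClosed F] [FiniteDimensional F 𝔤]
    (hG : G.IsQuasireductive) (hH : H.IsCartanSubalgebra) :
    ⨆ μ, G.adjoint.weightSpace H μ = ⊤ :=
  hG.iSup_weightSpace_eq_top H hH G.adjoint ⟨‹_›, hG.2⟩

end LieSuperalgebra

end SuperWeights

/-! ### The order on weights, and submodules generated by primitive spaces. -/

section HighestWeight

variable {F 𝔤 : Type*} [Field F] [AddCommGroup 𝔤] [Module F 𝔤] {G : LieSuperalgebra F 𝔤}
variable {V : Type*} [AddCommGroup V] [Module F V]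
variable [CharZero F] (H : LieSubalgebra F G.even)

namespace LieSuperalgebra

/-- Elements of the root lattice on which `γ` is positive. -/
def IsPos (γ : rootLattice H →+ ℝ) (q : Module.Dual F H) : Prop :=
  ∃ hq : q ∈ rootLattice H, 0 < γ ⟨q, hq⟩

variable {H} {γ : rootLattice H →+ ℝ}

theorem IsPos.add {p q : Module.Dual F H} (hp : IsPos H γ p) (hq : IsPos H γ q) :
    IsPos H γ (p + q) := by
  obtain ⟨hp, hp'⟩ := hp
  obtain ⟨hq, hq'⟩ := hq
  refine ⟨add_mem hp hq, ?_⟩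
  rw [show (⟨p + q, add_mem hp hq⟩ : rootLattice H) = ⟨p, hp⟩ + ⟨q, hq⟩ from rfl, map_add]
  exact add_pos hp' hq'

theorem not_isPos_zero : ¬ IsPos H γ 0 := by
  rintro ⟨h, h'⟩
  rw [show (⟨0, h⟩ : rootLattice H) = 0 from rfl, map_zero] at h'
  exact lt_irrefl _ h'

theorem not_isPos_sub_symm {p q : Module.Dual F H} (h : IsPos H γ (p - q)) :
    ¬ IsPos H γ (q - p) := fun h' => not_isPos_zero (by simpa using h.add h')

theorem isPos_of_mem_positiveRoots {α : Module.Dual F H} (hα : α ∈ positiveRoots H γ) :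
    IsPos H γ α := ⟨AddSubgroup.subset_closure hα.1, hα.2⟩

theorem WeightLE.refl (μ : Module.Dual F H) : WeightLE H γ μ μ := ⟨0, by simp, by simp⟩

theorem WeightLE.add_root {μ ν α : Module.Dual F H} (h : WeightLE H γ μ ν)
    (hα : α ∈ positiveRoots H γ) : WeightLE H γ μ (ν + α) := by
  classical
  obtain ⟨m, hm, rfl⟩ := h
  refine ⟨m + Finsupp.single α 1, fun β hβ => ?_, ?_⟩
  · rcases Finset.mem_union.1 (Finsupp.support_add hβ) with h | h
    · exact hm β h
    · rw [Finset.mem_singleton.1 (Finsupp.support_single_subset h)]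
      exact hα
  · have h1 : (Finsupp.single α 1).sum (fun (β : Module.Dual F H) (n : ℕ) => n • β) = α := by simp
    rw [Finsupp.sum_add_index' (by simp) (fun a b c => add_smul _ _ _), h1, add_assoc]

/-- A nonempty sum of positive roots has positive γ. This passes from `WeightLE` to the coarser
comparison by γ, which is antisymmetric for a trivial reason. -/
theorem WeightLE.eq_or_isPos {μ ν : Module.Dual F H} (h : WeightLE H γ μ ν) :
    ν = μ ∨ IsPos H γ (ν - μ) := by
  obtain ⟨m, hm, rfl⟩ := h
  rw [add_eq_left, add_sub_cancel_left]
  have key : ∀ s : Finset (Module.Dual F H), s ⊆ m.support →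
      ∑ α ∈ s, m α • α = 0 ∨ IsPos H γ (∑ α ∈ s, m α • α) := by
    classical
    intro s
    induction s using Finset.induction_on with
    | empty => intro _; exact Or.inl rfl
    | insert α s hαs ih =>
      intro hs
      rw [Finset.sum_insert hαs]
      have hα := hs (Finset.mem_insert_self α s)
      have hpos : ∀ n : ℕ, IsPos H γ ((n + 1) • α) := by
        intro n
        induction n with
        | zero => simpa using isPos_of_mem_positiveRoots (hm α hα)
        | succ n ih =>
          rw [succ_nsmul]
          exact ih.add (isPos_of_mem_positiveRoots (hm α hα))
      obtain ⟨n, hn⟩ := Nat.exists_eq_succ_of_ne_zero (Finsupp.mem_support_iff.1 hα)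
      rw [hn]
      refine Or.inr ?_
      rcases ih fun β hβ => hs (Finset.mem_insert_of_mem hβ) with h | h
      · rw [h, add_zero]; exact hpos n
      · exact (hpos n).add h
  exact key m.support subset_rfl

theorem WeightLE.antisymm {μ ν : Module.Dual F H} (h : WeightLE H γ μ ν)
    (h' : WeightLE H γ ν μ) : μ = ν := by
  rcases h.eq_or_isPos with e | p
  · exact e.symm
  rcases h'.eq_or_isPos with e | p'
  · exact e
  exact absurd p (not_isPos_sub_symm p')

variable (H γ) in
/-- The sum `𝔫⁻` of the root spaces of negative roots. -/
def lowering : Submodule F 𝔤 :=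
  ⨆ α : {α : roots H // γ (rootOf H α) < 0}, G.adjoint.weightSpace H α

variable (H γ) in
theorem isGraded_lowering : G.IsGraded (lowering H γ) :=
  Superspace.IsGraded.iSup fun α => G.adjoint.isGraded_weightSpace H α

/-- The decomposition `𝔤 = 𝔫⁻ ⊕ 𝔥 ⊕ 𝔫⁺`, as an induction principle. -/
theorem triangular_induction (htop : ⨆ α, G.adjoint.weightSpace H α = ⊤)
    (hγ : ∀ α : roots H, γ (rootOf H α) ≠ 0) (T : Submodule F 𝔤) (hlow : lowering H γ ≤ T)
    (hcart : (cartan H).carrier ≤ T)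
    (hpos : ∀ α ∈ positiveRoots H γ, G.adjoint.weightSpace H α ≤ T) : T = ⊤ := by
  rw [eq_top_iff, ← htop]
  refine iSup_le fun α => ?_
  by_cases hα : α = 0
  · subst hα
    intro x hx
    refine hcart fun h => ?_
    have h1 : G.bracket ((h : G.even) : 𝔤) x = (0 : Module.Dual F H) h • x := hx h
    rw [h1, LinearMap.zero_apply, zero_smul]
  by_cases hw : G.adjoint.weightSpace H α = ⊥
  · rw [hw]; exact bot_le
  have hr : α ∈ roots H := ⟨hα, hw⟩
  rcases lt_or_gt_of_ne (hγ ⟨α, hr⟩) with h | h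
  · exact le_trans (le_iSup (fun α : {α : roots H // γ (rootOf H α) < 0} =>
      G.adjoint.weightSpace H α) ⟨⟨α, hr⟩, h⟩) hlow
  · exact hpos α ⟨hr, h⟩

end LieSuperalgebra

namespace SuperModule

open LieSuperalgebra

variable (M : SuperModule G V) (γ : rootLattice H →+ ℝ)

/-- The smallest `𝔫⁻`-stable subspace containing `S`. -/
def lowerSpan (S : Submodule F V) : Submodule F V :=
  sInf {T | S ≤ T ∧ ∀ y ∈ lowering H γ, ∀ v ∈ T, M.act y v ∈ T}

theorem le_lowerSpan (S : Submodule F V) : S ≤ M.lowerSpan H γ S := le_sInf fun _ hT => hT.1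

variable {H γ}

theorem lowerSpan_le {S T : Submodule F V} (hS : S ≤ T)
    (hT : ∀ y ∈ lowering H γ, ∀ v ∈ T, M.act y v ∈ T) : M.lowerSpan H γ S ≤ T :=
  sInf_le ⟨hS, hT⟩

theorem act_mem_lowerSpan {S : Submodule F V} {y : 𝔤} (hy : y ∈ lowering H γ) {v : V}
    (hv : v ∈ M.lowerSpan H γ S) : M.act y v ∈ M.lowerSpan H γ S :=
  Submodule.mem_sInf.2 fun T hT => hT.2 y hy v (Submodule.mem_sInf.1 hv T hT)

/-- Graded, `𝔥`-stable spaces of vectors of weight `lam` that are killed by `𝔫⁺`. -/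
structure IsPrimitive (γ : rootLattice H →+ ℝ) (lam : Module.Dual F H) (S : Submodule F V) :
    Prop where
  le_weightSpace : S ≤ M.weightSpace H lam
  isGraded : M.IsGraded S
  cartan_mem : ∀ x ∈ (cartan H).carrier, ∀ v ∈ S, M.act x v ∈ S
  act_eq_zero : ∀ α ∈ positiveRoots H γ, ∀ x ∈ G.adjoint.weightSpace H α, ∀ v ∈ S, M.act x v = 0

/-- The sum of the homogeneous parts of U(𝔫⁻)S contains S and is 𝔫⁻-stable because 𝔫⁻ is graded, so
by minimality it is all of U(𝔫⁻)S. -/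
theorem isGraded_lowerSpan {S : Submodule F V} (hS : M.IsGraded S) :
    M.IsGraded (M.lowerSpan H γ S) := by
  have hle := M.le_lowerSpan H γ S
  set N := M.lowerSpan H γ S with hN
  have hom : ∀ i, ∀ v ∈ N, v ∈ M.part i → v ∈ (N ⊓ M.part 0) ⊔ (N ⊓ M.part 1) := by
    intro i v hv hi
    fin_cases i
    · exact Submodule.mem_sup_left ⟨hv, hi⟩
    · exact Submodule.mem_sup_right ⟨hv, hi⟩
  refine M.lowerSpan_le (hS.trans (sup_le_sup (inf_le_inf_right _ hle) (inf_le_inf_right _ hle))) ?_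
  intro y hy v hv
  obtain ⟨a, ha, b, hb, rfl⟩ := Submodule.mem_sup.1 hv
  obtain ⟨y₀, h₀, hy₀, y₁, h₁, hy₁, rfl⟩ := (isGraded_lowering H γ).exists_add hy
  simp only [map_add, LinearMap.add_apply]
  exact add_mem
    (add_mem (hom _ _ (M.act_mem_lowerSpan h₀ ha.1) (M.act_mem _ _ _ hy₀ _ ha.2))
      (hom _ _ (M.act_mem_lowerSpan h₁ ha.1) (M.act_mem _ _ _ hy₁ _ ha.2)))
    (add_mem (hom _ _ (M.act_mem_lowerSpan h₀ hb.1) (M.act_mem _ _ _ hy₀ _ hb.2))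
      (hom _ _ (M.act_mem_lowerSpan h₁ hb.1) (M.act_mem _ _ _ hy₁ _ hb.2)))

namespace IsPrimitive

variable {M} {lam : Module.Dual F H} {S : Submodule F V}

/-- The submodule generated by a primitive space `S` is `U(𝔫⁻) S`. -/
theorem isSubmodule_lowerSpan (hS : M.IsPrimitive γ lam S)
    (htop : ⨆ α, G.adjoint.weightSpace H α = ⊤) (hγ : ∀ α : roots H, γ (rootOf H α) ≠ 0) :
    M.IsSubmodule (M.lowerSpan H γ S) := by
  refine ⟨M.isGraded_lowerSpan hS.isGraded, ?_⟩
  set N := M.lowerSpan H γ S with hN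
  have hSN : S ≤ N := M.le_lowerSpan H γ S
  have hSact : ∀ v ∈ S, ∀ x, M.act x v ∈ N := by
    intro v hv x
    have h := triangular_induction htop hγ (N.comap (M.act.flip v))
      (fun y hy => M.act_mem_lowerSpan hy (hSN hv))
      (fun x hx => hSN (hS.cartan_mem x hx v hv))
      (fun α hα x hx => by
        rw [Submodule.mem_comap, LinearMap.flip_apply, hS.act_eq_zero α hα x hx v hv]
        exact zero_mem _)
    exact (h ▸ trivial : x ∈ N.comap (M.act.flip v))
  -- T consists of the vectors of N that all of 𝔤 sends into N. It contains S by the triangular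
  -- decomposition; once it is 𝔫⁻-stable, minimality of N gives N ≤ T.
  let T : Submodule F V := N ⊓ ⨅ x, N.comap (M.act x)
  have hT : ∀ v, v ∈ T ↔ v ∈ N ∧ ∀ x, M.act x v ∈ N := by
    intro v
    simp [T, Submodule.mem_iInf]
  have hom : ∀ i, ∀ y ∈ lowering H γ, y ∈ G.part i → ∀ v ∈ T, M.act y v ∈ T := by
    intro i y hy hi v hv
    rw [hT] at hv ⊢
    refine ⟨M.act_mem_lowerSpan hy hv.1, ?_⟩
    refine G.induction_homogeneous (fun j x hx => ?_) fun x x' hx hx' => ?_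
    · have h := M.act_bracket j i x hx y hi v
      rw [eq_sub_iff_add_eq] at h
      rw [← h]
      exact add_mem (hv.2 _) (N.smul_mem _ (M.act_mem_lowerSpan hy (hv.2 x)))
    · rw [map_add]
      exact add_mem hx hx'
  have hNT : N ≤ T := by
    refine M.lowerSpan_le (fun v hv => (hT v).2 ⟨hSN hv, hSact v hv⟩) fun y hy v hv => ?_
    obtain ⟨y₀, h₀, hy₀, y₁, h₁, hy₁, rfl⟩ := (isGraded_lowering H γ).exists_add hy
    rw [map_add]
    exact add_mem (hom 0 y₀ h₀ hy₀ v hv) (hom 1 y₁ h₁ hy₁ v hv)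
  exact fun a v hv => ((hT v).1 (hNT hv)).2 a

/-- The right-hand side contains S and is 𝔫⁻-stable: a negative root vector sends weight `lam`, or
any lower weight, to a strictly lower one. -/
theorem lowerSpan_le_sup (hS : M.IsPrimitive γ lam S) :
    M.lowerSpan H γ S ≤
      S ⊔ ⨆ μ : {μ : Module.Dual F H // IsPos H γ (lam - μ)}, M.weightSpace H μ := by
  have hmem : ∀ μ, IsPos H γ (lam - μ) → ∀ v ∈ M.weightSpace H μ,
      v ∈ S ⊔ ⨆ μ : {μ : Module.Dual F H // IsPos H γ (lam - μ)}, M.weightSpace H μ :=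
    fun μ hμ v hv => Submodule.mem_sup_right (Submodule.mem_iSup_of_mem
      (p := fun μ : {μ : Module.Dual F H // IsPos H γ (lam - μ)} => M.weightSpace H μ) ⟨μ, hμ⟩ hv)
  refine M.lowerSpan_le le_sup_left fun y hy v hv => ?_
  induction hy using Submodule.iSup_induction' with
  | mem α y hy =>
    have hα : IsPos H γ (-(α : Module.Dual F H)) := by
      refine ⟨neg_mem (rootOf H α).2, ?_⟩
      have h : γ (-rootOf H α) = -γ (rootOf H α) := map_neg _ _
      exact lt_of_lt_of_eq (neg_pos.2 α.2) h.symm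
    obtain ⟨s, hs, w, hw, rfl⟩ := Submodule.mem_sup.1 hv
    rw [map_add]
    refine add_mem (hmem (α + lam) (by simpa using hα) _
      (M.act_mem_weightSpace H hy (hS.le_weightSpace hs))) ?_
    clear hv
    induction hw using Submodule.iSup_induction' with
    | mem μ w hw =>
      refine hmem (α + μ) ?_ _ (M.act_mem_weightSpace H hy hw)
      have h := μ.2.add hα
      rwa [show lam - (μ : Module.Dual F H) + -α = lam - (α + μ) by abel] at h
    | zero => rw [map_zero]; exact zero_mem _
    | add x y _ _ hx hy => rw [map_add]; exact add_mem hx hy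
  | zero => rw [map_zero]; exact zero_mem _
  | add x y _ _ hx hy => rw [map_add]; exact add_mem hx hy

/-- The `lam`-weight space of the submodule generated by `S` is `S`. -/
theorem lowerSpan_inf_weightSpace_le (hS : M.IsPrimitive γ lam S) (hH : LieRing.IsNilpotent H) :
    M.lowerSpan H γ S ⊓ M.weightSpace H lam ≤ S := by
  rintro v ⟨hv, hvl⟩
  obtain ⟨s, hs, w, hw, rfl⟩ := Submodule.mem_sup.1 (hS.lowerSpan_le_sup hv)
  have hw' : w ∈ M.weightSpace H lam := by
    simpa using sub_mem hvl (hS.le_weightSpace hs)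
  have hle : ⨆ μ : {μ : Module.Dual F H // IsPos H γ (lam - μ)}, M.weightSpace H μ ≤
      ⨆ μ, ⨆ (_ : μ ≠ lam), M.weightSpace H μ := by
    refine iSup_le fun μ => ?_
    have hne : (μ : Module.Dual F H) ≠ lam := by
      intro h
      have := μ.2
      rw [h, sub_self] at this
      exact not_isPos_zero this
    exact le_iSup₂_of_le (μ : Module.Dual F H) hne le_rfl
  have h0 := Submodule.disjoint_def.1 (M.iSupIndep_weightSpace H hH lam) w hw' (hle hw)
  rw [h0, add_zero]
  exact hs

/-- If `S` generates `M`, then all other weights are lower than `lam`. -/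
theorem eq_or_isPos_of_lowerSpan_eq_top (hS : M.IsPrimitive γ lam S)
    (hH : LieRing.IsNilpotent H) (hgen : M.lowerSpan H γ S = ⊤) {μ : Module.Dual F H}
    (hμ : μ ∈ M.weights H) : μ = lam ∨ IsPos H γ (lam - μ) := by
  -- Otherwise the whole module lies in the sum of the weight spaces other than M_μ, and
  -- independence forces M_μ = 0.
  by_contra! hcon
  refine hμ ?_
  have hle : (⊤ : Submodule F V) ≤ ⨆ ν, ⨆ (_ : ν ≠ μ), M.weightSpace H ν := by
    rw [← hgen]
    refine hS.lowerSpan_le_sup.trans (sup_le ?_ (iSup_le fun ν => ?_))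
    · exact hS.le_weightSpace.trans (le_iSup₂_of_le lam (Ne.symm hcon.1) le_rfl)
    · exact le_iSup₂_of_le (ν : Module.Dual F H) (fun h => hcon.2 (h ▸ ν.2)) le_rfl
  exact Submodule.eq_bot_iff _ |>.2 fun v hv =>
    Submodule.disjoint_def.1 (M.iSupIndep_weightSpace H hH μ) v hv (hle trivial)

end IsPrimitive

end SuperModule

end HighestWeight

/-! ### Existence of the highest weight and simplicity of its weight space. -/

section HighestWeight

variable {F 𝔤 : Type*} [Field F] [AddCommGroup 𝔤] [Module F 𝔤] {G : LieSuperalgebra F 𝔤}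
variable {V : Type*} [AddCommGroup V] [Module F V]
variable [CharZero F] {H : LieSubalgebra F G.even}

namespace SuperModule

open LieSuperalgebra

variable {M : SuperModule G V} {γ : rootLattice H →+ ℝ}

variable (γ) in
/-- Every weight lies below a maximal weight. -/
theorem exists_maximal_weight [FiniteDimensional F V] (hH : LieRing.IsNilpotent H)
    {μ : Module.Dual F H} (hμ : μ ∈ M.weights H) :
    ∃ ν ∈ M.weights H, WeightLE H γ μ ν ∧ ∀ α ∈ positiveRoots H γ, ν + α ∉ M.weights H := by
  have : IsStrictOrder (Module.Dual F H) fun a b => IsPos H γ (a - b) :=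
    { irrefl := fun a h => not_isPos_zero (by simpa using h)
      trans := fun a b c h h' => by simpa using h.add h' }
  have hfin : {ν | ν ∈ M.weights H ∧ WeightLE H γ μ ν}.Finite :=
    (M.finite_weights H hH).subset fun ν h => h.1
  -- The relation says that `a` is strictly above `b`, so a minimal element for it is a maximal
  -- weight.
  obtain ⟨ν, -, hν⟩ := (hfin.wellFoundedOn (r := fun a b => IsPos H γ (a - b))).has_min
    Set.univ ⟨⟨μ, hμ, WeightLE.refl μ⟩, trivial⟩
  refine ⟨ν, ν.2.1, ν.2.2, fun α hα h => ?_⟩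
  exact hν ⟨_, h, ν.2.2.add_root hα⟩ trivial
    (by simpa using isPos_of_mem_positiveRoots hα)

theorem isPrimitive_of_le {lam : Module.Dual F H}
    (h : ∀ α ∈ positiveRoots H γ, lam + α ∉ M.weights H) {S : Submodule F V}
    (hle : S ≤ M.weightSpace H lam) (hgr : M.IsGraded S)
    (hcart : ∀ x ∈ (cartan H).carrier, ∀ v ∈ S, M.act x v ∈ S) : M.IsPrimitive γ lam S where
  le_weightSpace := hle
  isGraded := hgr
  cartan_mem := hcart
  act_eq_zero α hα x hx v hv := by
    have h1 := M.act_mem_weightSpace H hx (hle hv)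
    have h2 : M.weightSpace H (α + lam) = ⊥ := by
      rw [add_comm]
      exact not_not.1 (h α hα)
    rw [h2] at h1
    exact h1

theorem isPrimitive_weightSpace {lam : Module.Dual F H}
    (h : ∀ α ∈ positiveRoots H γ, lam + α ∉ M.weights H) :
    M.IsPrimitive γ lam (M.weightSpace H lam) :=
  isPrimitive_of_le h le_rfl (M.isGraded_weightSpace H lam) fun x hx v hv =>
    (M.isSubmodule_weightSpace H lam).2 ⟨x, hx⟩ v hv

theorem IsHighestWeight.add_notMem_weights {lam : Module.Dual F H}
    (h : M.IsHighestWeight H γ lam) : ∀ α ∈ positiveRoots H γ, lam + α ∉ M.weights H := by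
  intro α hα hmem
  have hp := isPos_of_mem_positiveRoots hα
  rcases (h.2 _ hmem).eq_or_isPos with e | p
  · rw [left_eq_add] at e
    rw [e] at hp
    exact not_isPos_zero hp
  · rw [sub_add_cancel_left] at p
    exact not_isPos_zero (by simpa using hp.add p)

theorem IsHighestWeight.eq {lam lam' : Module.Dual F H} (h : M.IsHighestWeight H γ lam)
    (h' : M.IsHighestWeight H γ lam') : lam = lam' :=
  (h'.2 _ h.1).antisymm (h.2 _ h'.1)

theorem IsPrimitive.lowerSpan_eq_top {lam : Module.Dual F H} {S : Submodule F V}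
    (hS : M.IsPrimitive γ lam S) (hM : M.IsSimple) (htop : ⨆ α, G.adjoint.weightSpace H α = ⊤)
    (hγ : ∀ α : roots H, γ (rootOf H α) ≠ 0) (hS0 : S ≠ ⊥) : M.lowerSpan H γ S = ⊤ := by
  refine (hM.2 _ (hS.isSubmodule_lowerSpan htop hγ)).resolve_left fun h => hS0 ?_
  rw [eq_bot_iff, ← h]
  exact M.le_lowerSpan H γ S

/-- Generation by a primitive space compares weights only through γ. The stronger `WeightLE` comes
from climbing: every weight is `WeightLE` some maximal weight, and there is only one maximal weight.
-/
theorem IsSimple.exists_isHighestWeight [FiniteDimensional F V] (hM : M.IsSimple)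
    (hH : LieRing.IsNilpotent H) (htop : ⨆ α, G.adjoint.weightSpace H α = ⊤)
    (hγ : ∀ α : roots H, γ (rootOf H α) ≠ 0) (hVtop : ⨆ μ, M.weightSpace H μ = ⊤) :
    ∃ lam, M.IsHighestWeight H γ lam := by
  have := hM.1
  obtain ⟨μ, hμ⟩ : ∃ μ, μ ∈ M.weights H := by
    by_contra! hcon
    have h : ⨆ μ, M.weightSpace H μ = ⊥ := iSup_eq_bot.2 fun μ => not_not.1 (hcon μ)
    exact bot_ne_top (h.symm.trans hVtop)
  obtain ⟨lam, hlam, -, hmax⟩ := exists_maximal_weight γ hH hμ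
  refine ⟨lam, hlam, fun ν hν => ?_⟩
  obtain ⟨κ, hκ, hle, hmax'⟩ := exists_maximal_weight γ hH hν
  have hp := isPrimitive_weightSpace hmax
  have hp' := isPrimitive_weightSpace hmax'
  -- The weight spaces of `lam` and `κ` both generate M, so if the two differ each is strictly below
  -- the other.
  rcases hp.eq_or_isPos_of_lowerSpan_eq_top hH (hp.lowerSpan_eq_top hM htop hγ hlam) hκ with e | p
  · exact e ▸ hle
  rcases hp'.eq_or_isPos_of_lowerSpan_eq_top hH (hp'.lowerSpan_eq_top hM htop hγ hκ) hlam
    with e | p'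
  · exact e ▸ hle
  exact absurd p (not_isPos_sub_symm p')

/-- A nonzero 𝔥-submodule of M_λ is primitive, so it generates M; but the λ-weight space of what it
generates is that submodule itself. -/
theorem IsHighestWeight.isSimple_weightModule {lam : Module.Dual F H}
    (h : M.IsHighestWeight H γ lam) (hM : M.IsSimple) (hH : LieRing.IsNilpotent H)
    (htop : ⨆ α, G.adjoint.weightSpace H α = ⊤) (hγ : ∀ α : roots H, γ (rootOf H α) ≠ 0) :
    (M.weightModule H lam).IsSimple := by
  refine ⟨Submodule.nontrivial_iff_ne_bot.2 h.1, fun N hN => or_iff_not_imp_left.2 fun hN0 => ?_⟩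
  have hle : N.map (M.weightSpace H lam).subtype ≤ M.weightSpace H lam :=
    Submodule.map_subtype_le _ _
  have hp : M.IsPrimitive γ lam (N.map (M.weightSpace H lam).subtype) := by
    refine isPrimitive_of_le h.add_notMem_weights hle ?_ ?_
    · rintro _ ⟨v, hv, rfl⟩
      obtain ⟨a, ha, ha0, b, hb, hb1, rfl⟩ := Superspace.IsGraded.exists_add hN.1 hv
      exact Submodule.mem_sup.2 ⟨a, ⟨⟨a, ha, rfl⟩, ha0⟩, b, ⟨⟨b, hb, rfl⟩, hb1⟩, rfl⟩
    · rintro x hx _ ⟨v, hv, rfl⟩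
      exact ⟨_, hN.2 ⟨x, hx⟩ v hv, rfl⟩
  have hgen := hp.lowerSpan_eq_top hM htop hγ fun h =>
    hN0 (Submodule.map_injective_of_injective Subtype.val_injective
      (h.trans (Submodule.map_bot _).symm))
  rw [eq_top_iff]
  intro v _
  obtain ⟨w, hw, hwv⟩ := hp.lowerSpan_inf_weightSpace_le hH ⟨hgen ▸ trivial, v.2⟩
  rwa [← Subtype.ext hwv]

end SuperModule

end HighestWeight

/-! ### Even homomorphisms, direct sums and graphs of isomorphisms. -/

section Homomorphisms

variable {F 𝔤 : Type*} [Field F] [AddCommGroup 𝔤] [Module F 𝔤] {G : LieSuperalgebra F 𝔤}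
variable {V W : Type*} [AddCommGroup V] [Module F V] [AddCommGroup W] [Module F W]

theorem Superspace.eq_of_add_eq (S : Superspace F V) {a b a' b' : V} (ha : a ∈ S.part 0)
    (hb : b ∈ S.part 1) (ha' : a' ∈ S.part 0) (hb' : b' ∈ S.part 1) (h : a + b = a' + b') :
    a = a' ∧ b = b' := by
  have h1 : a - a' = b' - b := by rw [sub_eq_sub_iff_add_eq_add, h, add_comm b']
  have h2 := Submodule.disjoint_def.1 S.isCompl.disjoint _ ((S.part 0).sub_mem ha ha')
    (h1 ▸ (S.part 1).sub_mem hb' hb)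
  exact ⟨sub_eq_zero.1 h2, (sub_eq_zero.1 (h1.symm.trans h2)).symm⟩

theorem Superspace.exists_homogeneous_ne_zero [Nontrivial V] (S : Superspace F V) :
    ∃ i, ∃ v ∈ S.part i, v ≠ 0 := by
  obtain ⟨v, hv⟩ := exists_ne (0 : V)
  obtain ⟨a, ha, b, hb, rfl⟩ := S.exists_add v
  by_cases h : a = 0
  · exact ⟨1, b, hb, fun h' => hv (by rw [h, h', add_zero])⟩
  · exact ⟨0, a, ha, h⟩

namespace SuperModule

/-- Even homomorphisms of modules. -/
structure IsHom (M : SuperModule G V) (N : SuperModule G W) (f : V →ₗ[F] W) : Prop where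
  map_part : ∀ i, ∀ v ∈ M.part i, f v ∈ N.part i
  map_act : ∀ a v, f (M.act a v) = N.act a (f v)

variable {M : SuperModule G V} {N : SuperModule G W} {f : V →ₗ[F] W}

theorem IsHom.isSubmodule_map (hf : M.IsHom N f) {P : Submodule F V} (hP : M.IsSubmodule P) :
    N.IsSubmodule (P.map f) := by
  constructor
  · rintro _ ⟨v, hv, rfl⟩
    obtain ⟨a, ha, ha0, b, hb, hb1, rfl⟩ := hP.1.exists_add hv
    exact Submodule.mem_sup.2 ⟨f a, ⟨⟨a, ha, rfl⟩, hf.map_part 0 a ha0⟩,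
      f b, ⟨⟨b, hb, rfl⟩, hf.map_part 1 b hb1⟩, (map_add f a b).symm⟩
  · rintro x _ ⟨v, hv, rfl⟩
    exact ⟨_, hP.2 x v hv, hf.map_act x v⟩

theorem IsHom.isSubmodule_comap (hf : M.IsHom N f) {P : Submodule F W} (hP : N.IsSubmodule P) :
    M.IsSubmodule (P.comap f) := by
  constructor
  · intro v hv
    obtain ⟨a, ha, b, hb, rfl⟩ := M.exists_add v
    obtain ⟨a', ha', ha0, b', hb', hb1, h⟩ := hP.1.exists_add hv
    rw [map_add] at h
    obtain ⟨rfl, rfl⟩ := N.eq_of_add_eq ha0 hb1 (hf.map_part 0 a ha) (hf.map_part 1 b hb) h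
    exact Submodule.mem_sup.2 ⟨a, ⟨ha', ha⟩, b, ⟨hb', hb⟩, rfl⟩
  · intro x v hv
    rw [Submodule.mem_comap, hf.map_act]
    exact hP.2 x _ hv

variable (M N) in
/-- The direct sum of two modules. -/
def prod : SuperModule G (V × W) where
  part i := (M.part i).prod (N.part i)
  isCompl := by
    constructor
    · rw [Submodule.disjoint_def]
      rintro ⟨v, w⟩ h0 h1
      exact Prod.ext (Submodule.disjoint_def.1 M.isCompl.disjoint v h0.1 h1.1)
        (Submodule.disjoint_def.1 N.isCompl.disjoint w h0.2 h1.2)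
    · rw [codisjoint_iff, eq_top_iff]
      rintro ⟨v, w⟩ -
      obtain ⟨a, ha, b, hb, rfl⟩ := M.exists_add v
      obtain ⟨c, hc, d, hd, rfl⟩ := N.exists_add w
      exact Submodule.mem_sup.2 ⟨(a, c), ⟨ha, hc⟩, (b, d), ⟨hb, hd⟩, rfl⟩
  act := LinearMap.mk₂ F (fun a p => (M.act a p.1, N.act a p.2))
    (by intros; simp) (by intros; simp) (by intros; simp) (by intros; simp)
  act_mem i j a ha v hv := ⟨M.act_mem i j a ha _ hv.1, N.act_mem i j a ha _ hv.2⟩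
  act_bracket i j a ha b hb v :=
    Prod.ext (M.act_bracket i j a ha b hb _) (N.act_bracket i j a ha b hb _)

variable (M N) in
theorem isHom_fst : (M.prod N).IsHom M (LinearMap.fst F V W) :=
  ⟨fun _ _ hv => hv.1, fun _ _ => rfl⟩

variable (M N) in
theorem isHom_snd : (M.prod N).IsHom N (LinearMap.snd F V W) :=
  ⟨fun _ _ hv => hv.2, fun _ _ => rfl⟩

variable (M N) in
theorem isHom_inl : M.IsHom (M.prod N) (LinearMap.inl F V W) :=
  ⟨fun _ _ hv => ⟨hv, zero_mem _⟩, fun _ _ => Prod.ext rfl (map_zero _).symm⟩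

variable (M N) in
theorem isHom_inr : N.IsHom (M.prod N) (LinearMap.inr F V W) :=
  ⟨fun _ _ hv => ⟨zero_mem _, hv⟩, fun _ _ => Prod.ext (map_zero _).symm rfl⟩

/-- A submodule of `M ⊕ N` which is neither contained in nor contains one of the simple summands
is the graph of an isomorphism. -/
theorem nonempty_iso_of_isSubmodule_prod (hM : M.IsSimple) (hN : N.IsSimple)
    {P : Submodule F (V × W)} (hP : (M.prod N).IsSubmodule P)
    (hfst : ∃ p ∈ P, p.1 ≠ 0) (hsnd : ∃ p ∈ P, p.2 ≠ 0)
    (hinl : ∃ v, (v, 0) ∉ P) (hinr : ∃ w, (0, w) ∉ P) : Nonempty (M.Iso N) := by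
  -- Goursat's argument: by simplicity P meets each summand trivially and projects onto each, so
  -- both projections of P are bijective.
  have hl : ∀ v, (v, 0) ∈ P → v = 0 := by
    have h := (hM.2 _ ((isHom_inl M N).isSubmodule_comap hP)).resolve_right fun h => by
      obtain ⟨v, hv⟩ := hinl
      exact hv (show v ∈ P.comap (LinearMap.inl F V W) from h ▸ trivial)
    intro v hv
    have h' : v ∈ P.comap (LinearMap.inl F V W) := hv
    rwa [h, Submodule.mem_bot] at h'
  have hr : ∀ w, (0, w) ∈ P → w = 0 := by
    have h := (hN.2 _ ((isHom_inr M N).isSubmodule_comap hP)).resolve_right fun h => by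
      obtain ⟨w, hw⟩ := hinr
      exact hw (show w ∈ P.comap (LinearMap.inr F V W) from h ▸ trivial)
    intro w hw
    have h' : w ∈ P.comap (LinearMap.inr F V W) := hw
    rwa [h, Submodule.mem_bot] at h'
  have h1 : P.map (LinearMap.fst F V W) = ⊤ :=
    (hM.2 _ ((isHom_fst M N).isSubmodule_map hP)).resolve_left fun h => by
      obtain ⟨p, hp, hp0⟩ := hfst
      exact hp0 ((Submodule.mem_bot F).1 (h ▸ ⟨p, hp, rfl⟩))
  have h2 : P.map (LinearMap.snd F V W) = ⊤ :=
    (hN.2 _ ((isHom_snd M N).isSubmodule_map hP)).resolve_left fun h => by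
      obtain ⟨p, hp, hp0⟩ := hsnd
      exact hp0 ((Submodule.mem_bot F).1 (h ▸ ⟨p, hp, rfl⟩))
  let e₁ : P ≃ₗ[F] V := LinearEquiv.ofBijective ((LinearMap.fst F V W).domRestrict P) <| by
    constructor
    · rw [injective_iff_map_eq_zero]
      rintro ⟨⟨v, w⟩, hp⟩ (rfl : v = 0)
      exact Subtype.ext (Prod.ext rfl (hr w hp))
    · intro v
      obtain ⟨p, hp, h⟩ : v ∈ P.map (LinearMap.fst F V W) := h1 ▸ trivial
      exact ⟨⟨p, hp⟩, h⟩
  let e₂ : P ≃ₗ[F] W := LinearEquiv.ofBijective ((LinearMap.snd F V W).domRestrict P) <| by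
    constructor
    · rw [injective_iff_map_eq_zero]
      rintro ⟨⟨v, w⟩, hp⟩ (rfl : w = 0)
      exact Subtype.ext (Prod.ext (hl v hp) rfl)
    · intro v
      obtain ⟨p, hp, h⟩ : v ∈ P.map (LinearMap.snd F V W) := h2 ▸ trivial
      exact ⟨⟨p, hp⟩, h⟩
  have he : ∀ p : P, (e₁.symm.trans e₂) (p : V × W).1 = (p : V × W).2 := by
    intro p
    have h : e₁.symm (p : V × W).1 = p := e₁.symm_apply_apply p
    rw [LinearEquiv.trans_apply, h]
    rfl
  have hsurj : ∀ v, ∃ p : P, (p : V × W).1 = v := fun v => e₁.surjective v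
  refine ⟨⟨e₁.symm.trans e₂, fun i v hv => ?_, fun a v => ?_⟩⟩
  · obtain ⟨⟨⟨v, w⟩, hp⟩, rfl⟩ := hsurj v
    rw [he]
    change w ∈ N.part i
    obtain ⟨⟨v₀, w₀⟩, ha, ha0, ⟨v₁, w₁⟩, hb, hb1, hab⟩ := hP.1.exists_add hp
    obtain ⟨rfl, rfl⟩ := Prod.mk_inj.1 hab
    have hv' : v₀ + v₁ ∈ M.part i := hv
    clear hab hp hv
    fin_cases i
    · have h := (M.eq_of_add_eq ha0.1 hb1.1 hv' (zero_mem _) (by rw [add_zero])).2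
      subst h
      rw [hr w₁ hb, add_zero]
      exact ha0.2
    · have h := (M.eq_of_add_eq ha0.1 hb1.1 (zero_mem _) hv' (by rw [zero_add])).1
      subst h
      rw [hr w₀ ha, zero_add]
      exact hb1.2
  · obtain ⟨p, rfl⟩ := hsurj v
    rw [he]
    exact he ⟨_, hP.2 a p p.2⟩

/-! ### Supercommuting maps between modules with equal scalar even action. -/

section Invariants

variable (M N) in
/-- Homogeneous linear maps that supercommute with given odd elements. -/
structure IsOddInvariant (X : Set 𝔤) (i : ZMod 2) (f : V →ₗ[F] W) : Prop where
  ne_zero : f ≠ 0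
  map_part : ∀ j, ∀ v ∈ M.part j, f v ∈ N.part (i + j)
  map_act : ∀ x ∈ X, ∀ v, N.act x (f v) = superSign F 1 i • f (M.act x v)

theorem superSign_one_add_one (i : ZMod 2) : superSign F 1 (i + 1) = -superSign F 1 i := by
  fin_cases i
  · change (-1 : F) ^ (1 * 1) = -(-1) ^ (1 * 0)
    norm_num
  · change (-1 : F) ^ (1 * 0) = -(-1) ^ (1 * 1)
    norm_num

theorem superSign_mul_self (i j : ZMod 2) : superSign F i j * superSign F i j = 1 := by
  rw [superSign, ← mul_pow]
  simp

theorem superSign_one_one : superSign F 1 1 = -1 := by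
  change (-1 : F) ^ (1 * 1) = -1
  norm_num

variable (M N) in
theorem exists_homogeneous_map [Nontrivial V] [Nontrivial W] :
    ∃ i f, IsOddInvariant M N ∅ i f := by
  obtain ⟨i, v, hv, hv0⟩ := M.exists_homogeneous_ne_zero
  obtain ⟨j, w, hw, hw0⟩ := N.exists_homogeneous_ne_zero
  have hdisj : Disjoint (M.part i) (M.part (i + 1)) := by
    fin_cases i
    · exact M.isCompl.disjoint
    · exact M.isCompl.disjoint.symm
  -- The functional φ is nonzero at v and kills the part of opposite parity, so the rank one map u ↦
  -- φ(u)w is homogeneous. Its degree j - i equals j + i modulo 2.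
  obtain ⟨φ, hφ, hker⟩ := Submodule.exists_le_ker_of_notMem
    (fun h => hv0 (Submodule.disjoint_def.1 hdisj v hv h))
  refine ⟨j + i, φ.smulRight w, ⟨fun h => ?_, fun k u hu => ?_, by simp⟩⟩
  · have h' := LinearMap.congr_fun h v
    rw [LinearMap.smulRight_apply, LinearMap.zero_apply] at h'
    exact (smul_ne_zero hφ hw0) h'
  · rw [LinearMap.smulRight_apply]
    by_cases hk : k = i
    · subst hk
      rw [add_assoc, show k + k = 0 from CharTwo.add_self_eq_zero k, add_zero]
      exact Submodule.smul_mem _ _ hw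
    · have hk' : k = i + 1 :=
        (show ∀ i k : ZMod 2, k ≠ i → k = i + 1 by decide) i k hk
      subst hk'
      rw [show φ u = 0 from hker hu, zero_smul]
      exact zero_mem _

/-- Let D_x be the supercommutator f ↦ x f - (-1)^{p(f)} f x. Since [y,x] acts by the same scalar on
both modules, D_y D_x + D_x D_y = 0, and in particular D_x² = 0. So either D_x f = 0 and f itself
serves, or D_x f is nonzero, is killed by D_x, and is still killed by D_y for y in X. -/
theorem IsOddInvariant.insert [CharZero F] {X : Set 𝔤} {i : ZMod 2}
    (hf : IsOddInvariant M N X i f) (hX : X ⊆ G.part 1) {x : 𝔤} (hx : x ∈ G.part 1)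
    (hscalar : ∀ a ∈ G.part 0, ∃ c : F, (∀ v, M.act a v = c • v) ∧ ∀ w, N.act a w = c • w) :
    ∃ i f, IsOddInvariant M N (insert x X) i f := by
  set ε := superSign F 1 i with hε
  have hεε : ε * ε = 1 := superSign_mul_self 1 i
  set g : V →ₗ[F] W := N.act x ∘ₗ f - ε • f ∘ₗ M.act x with hg
  have hgv : ∀ v, g v = N.act x (f v) - ε • f (M.act x v) := fun v => rfl
  by_cases h0 : g = 0
  · refine ⟨i, f, hf.ne_zero, hf.map_part, ?_⟩
    rintro y (rfl | hy) v
    · have h := hgv v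
      rw [h0, LinearMap.zero_apply] at h
      exact sub_eq_zero.1 h.symm
    · exact hf.map_act y hy v
  have hanti : ∀ y ∈ G.part 1, ∃ c : F,
      (∀ v, M.act y (M.act x v) + M.act x (M.act y v) = c • v) ∧
      ∀ w, N.act y (N.act x w) + N.act x (N.act y w) = c • w := by
    intro y hy
    obtain ⟨c, hc, hc'⟩ := hscalar (G.bracket y x) (by simpa using! G.bracket_mem 1 1 y hy x hx)
    refine ⟨c, fun v => ?_, fun w => ?_⟩
    · rw [← hc, M.act_bracket 1 1 y hy x hx, superSign_one_one, neg_one_smul, sub_neg_eq_add]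
    · rw [← hc', N.act_bracket 1 1 y hy x hx, superSign_one_one, neg_one_smul, sub_neg_eq_add]
  refine ⟨i + 1, g, h0, fun j v hv => ?_, ?_⟩
  · rw [hgv]
    refine sub_mem ?_ (Submodule.smul_mem _ _ ?_)
    · have h := N.act_mem 1 (i + j) x hx _ (hf.map_part j v hv)
      rwa [show 1 + (i + j) = i + 1 + j by ring] at h
    · have h := hf.map_part (1 + j) _ (M.act_mem 1 j x hx v hv)
      rwa [← add_assoc] at h
  · rw [superSign_one_add_one, ← hε]
    rintro y (rfl | hy) v
    · obtain ⟨c, hc, hc'⟩ := hanti y hx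
      have e1 := hc v
      have e2 := hc' (f v)
      rw [← two_smul F] at e1 e2
      have e3 := congrArg f e1
      rw [map_smul, map_smul, ← e2] at e3
      have e4 := smul_right_injective W (two_ne_zero (α := F)) e3
      simp only [hgv, map_sub, map_smul, smul_sub, smul_smul, neg_mul, hεε, neg_smul, one_smul, e4]
      abel
    · obtain ⟨c, hc, hc'⟩ := hanti y (hX hy)
      have e1 := congrArg f (hc v)
      have e2 := hc' (f v)
      rw [map_smul, ← e2, hf.map_act y hy] at e1
      simp only [hgv, map_sub, map_smul, smul_sub, smul_smul, neg_mul, hεε, neg_smul, one_smul,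
        hf.map_act y hy, map_add, ← hε] at e1 ⊢
      rw [← sub_eq_zero] at e1 ⊢
      rw [← neg_eq_zero, ← e1]
      abel

variable (M N) in
/-- Two modules on which the even part acts by the same scalars have a nonzero homogeneous
supercommuting map between them. -/
theorem exists_isOddInvariant [CharZero F] [FiniteDimensional F 𝔤] [Nontrivial V] [Nontrivial W]
    (hscalar : ∀ a ∈ G.part 0, ∃ c : F, (∀ v, M.act a v = c • v) ∧ ∀ w, N.act a w = c • w) :
    ∃ i f, IsOddInvariant M N (G.part 1) i f := by
  classical
  have key : ∀ s : Finset 𝔤, (s : Set 𝔤) ⊆ G.part 1 → ∃ i f, IsOddInvariant M N s i f := by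
    intro s
    induction s using Finset.induction_on with
    | empty =>
      intro _
      rw [Finset.coe_empty]
      exact exists_homogeneous_map M N
    | insert x s _ ih =>
      intro hs
      rw [Finset.coe_insert, Set.insert_subset_iff] at hs
      obtain ⟨i, f, hf⟩ := ih hs.2
      rw [Finset.coe_insert]
      exact hf.insert hs.2 hs.1 hscalar
  -- Supercommutation is linear in x, so a finite spanning set of the odd part suffices.
  obtain ⟨s, hs⟩ := IsNoetherian.noetherian (G.part 1)
  obtain ⟨i, f, hf⟩ := key s (hs ▸ Submodule.subset_span)
  refine ⟨i, f, hf.ne_zero, hf.map_part, fun x hx v => ?_⟩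
  rw [SetLike.mem_coe, ← hs] at hx
  induction hx using Submodule.span_induction with
  | mem x hx => exact hf.map_act x hx v
  | zero => simp
  | add x y _ _ hx hy => simp only [map_add, LinearMap.add_apply, hx, hy, smul_add]
  | smul c x _ hx => simp only [map_smul, LinearMap.smul_apply, hx, smul_comm c]

theorem IsOddInvariant.isHom {f : V →ₗ[F] W} (hf : IsOddInvariant M N (G.part 1) 0 f)
    (hscalar : ∀ a ∈ G.part 0, ∃ c : F, (∀ v, M.act a v = c • v) ∧ ∀ w, N.act a w = c • w) :
    M.IsHom N f := by
  refine ⟨fun j v hv => by simpa using hf.map_part j v hv, fun a v => ?_⟩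
  obtain ⟨a, ha, b, hb, rfl⟩ := G.exists_add a
  obtain ⟨c, hc, hc'⟩ := hscalar a ha
  simp only [map_add, LinearMap.add_apply, hc, hc', map_smul, hf.map_act b hb]
  simp [superSign]

/-- An odd f anticommutes with odd elements, whereas Π keeps the action without signs. Changing the
sign of f on the odd part of M turns anticommutation into commutation. -/
theorem IsOddInvariant.exists_isHom_parityChange {f : V →ₗ[F] W}
    (hf : IsOddInvariant M N (G.part 1) 1 f)
    (hscalar : ∀ a ∈ G.part 0, ∃ c : F, (∀ v, M.act a v = c • v) ∧ ∀ w, N.act a w = c • w) :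
    ∃ g ≠ 0, M.IsHom N.parityChange g := by
  let g : V →ₗ[F] W := LinearMap.ofIsCompl M.isCompl (f ∘ₗ (M.part 0).subtype)
    (-(f ∘ₗ (M.part 1).subtype))
  have g0 : ∀ v ∈ M.part 0, g v = f v := fun v hv =>
    LinearMap.ofIsCompl_apply_left M.isCompl ⟨v, hv⟩
  have g1 : ∀ v ∈ M.part 1, g v = -f v := fun v hv =>
    LinearMap.ofIsCompl_apply_right M.isCompl ⟨v, hv⟩
  refine ⟨g, fun h => hf.ne_zero (LinearMap.ext fun v => ?_), ?_, ?_⟩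
  · obtain ⟨a, ha, b, hb, rfl⟩ := M.exists_add v
    have e0 := g0 a ha
    have e1 := g1 b hb
    rw [h, LinearMap.zero_apply] at e0 e1
    rw [map_add, ← e0, neg_eq_zero.1 e1.symm, add_zero, LinearMap.zero_apply]
  · intro i v hv
    have h := hf.map_part i v hv
    rw [add_comm] at h
    fin_cases i
    · rw [g0 v hv]; exact h
    · rw [g1 v hv]; exact neg_mem h
  · intro a v
    change g (M.act a v) = N.act a (g v)
    obtain ⟨a, ha, b, hb, rfl⟩ := G.exists_add a
    obtain ⟨c, hc, hc'⟩ := hscalar a ha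
    simp only [map_add, LinearMap.add_apply, hc, hc', map_smul]
    congr 1
    refine M.induction_homogeneous (p := fun v => g (M.act b v) = N.act b (g v))
      (fun i v hv => ?_) (fun v w hv hw => by simp only [map_add, hv, hw]) v
    have h := hf.map_act b hb v
    rw [superSign_one_one, neg_one_smul] at h
    have hbv := M.act_mem 1 i b hb v hv
    fin_cases i
    · rw [g0 v hv, g1 _ hbv, h]
    · rw [g1 v hv, g0 _ hbv, map_neg, h, neg_neg]

end Invariants

end SuperModule

end Homomorphisms

/-! ### Simple modules with the same highest weight. -/

section Classification

variable {F 𝔤 : Type*} [Field F] [AddCommGroup 𝔤] [Module F 𝔤] {G : LieSuperalgebra F 𝔤}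
variable {V W : Type*} [AddCommGroup V] [Module F V] [AddCommGroup W] [Module F W]

namespace SuperModule

open LieSuperalgebra

variable {M : SuperModule G V} {N : SuperModule G W}

theorem isGraded_parityChange {P : Submodule F V} :
    M.parityChange.IsGraded P ↔ M.IsGraded P := by
  have h : (P ⊓ M.parityChange.part 0) ⊔ (P ⊓ M.parityChange.part 1) =
      (P ⊓ M.part 0) ⊔ (P ⊓ M.part 1) := sup_comm _ _
  rw [Superspace.IsGraded, h]
  rfl

theorem IsSimple.parityChange (hM : M.IsSimple) : M.parityChange.IsSimple :=
  ⟨hM.1, fun P hP => hM.2 P ⟨isGraded_parityChange.1 hP.1, hP.2⟩⟩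

variable [CharZero F] {H : LieSubalgebra F G.even} {γ : rootLattice H →+ ℝ}

/-- Even elements of the Cartan subalgebra lie in `𝔥₀`. -/
theorem _root_.LieSuperalgebra.exists_eq_of_mem_cartan (hH : H.IsCartanSubalgebra) {a : 𝔤}
    (ha : a ∈ (cartan H).carrier) (ha0 : a ∈ G.part 0) :
    ∃ h : H, ((h : G.even) : 𝔤) = a := by
  refine ⟨⟨⟨a, ha0⟩, ?_⟩, rfl⟩
  rw [← hH.self_normalizing, LieSubalgebra.mem_normalizer_iff]
  intro y hy
  have h : ⁅(⟨a, ha0⟩ : G.even), y⁆ = 0 := by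
    rw [← lie_skew, neg_eq_zero]
    exact Subtype.ext (ha ⟨y, hy⟩)
  rw [h]
  exact H.zero_mem

/-- A nonzero homomorphism between highest weight spaces extends to an isomorphism. -/
theorem nonempty_iso_of_isHom_weightModule (hM : M.IsSimple) (hN : N.IsSimple)
    (hH : LieRing.IsNilpotent H) (htop : ⨆ α, G.adjoint.weightSpace H α = ⊤)
    (hγ : ∀ α : roots H, γ (rootOf H α) ≠ 0) {lam : Module.Dual F H}
    (hlM : M.IsHighestWeight H γ lam) (hlN : N.IsHighestWeight H γ lam)
    {f : M.weightSpace H lam →ₗ[F] N.weightSpace H lam} (hf0 : f ≠ 0)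
    (hf : (M.weightModule H lam).IsHom (N.weightModule H lam) f) : Nonempty (M.Iso N) := by
  obtain ⟨v, hv⟩ : ∃ v, f v ≠ 0 := by
    by_contra! h
    exact hf0 (LinearMap.ext h)
  -- S is the graph of f inside the `lam`-weight space of M ⊕ N.
  set S : Submodule F (V × W) := LinearMap.range
    ((M.weightSpace H lam).subtype.prod ((N.weightSpace H lam).subtype ∘ₗ f)) with hSdef
  have hmem : ∀ u : M.weightSpace H lam, ((u : V), (f u : W)) ∈ S := fun u => ⟨u, rfl⟩
  have hS : (M.prod N).IsPrimitive γ lam S := by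
    constructor
    · rintro _ ⟨u, rfl⟩ h
      exact Prod.ext (u.2 h) ((f u).2 h)
    · rintro _ ⟨u, rfl⟩
      obtain ⟨a, ha, b, hb, rfl⟩ := (M.weightModule H lam).exists_add u
      rw [map_add]
      exact add_mem
        (Submodule.mem_sup_left ⟨hmem a, ha, hf.map_part 0 a ha⟩)
        (Submodule.mem_sup_right ⟨hmem b, hb, hf.map_part 1 b hb⟩)
    · rintro x hx _ ⟨u, rfl⟩
      have h := hmem ((M.weightModule H lam).act ⟨x, hx⟩ u)
      rw [hf.map_act] at h
      exact h
    · rintro α hα x hx _ ⟨u, rfl⟩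
      exact Prod.ext
        ((isPrimitive_weightSpace hlM.add_notMem_weights).act_eq_zero α hα x hx _ u.2)
        ((isPrimitive_weightSpace hlN.add_notMem_weights).act_eq_zero α hα x hx _ (f u).2)
  have hSP := (M.prod N).le_lowerSpan H γ S
  have hinf := hS.lowerSpan_inf_weightSpace_le hH
  -- The vector (v, f v) has both coordinates nonzero. Neither (v, 0) nor (0, f v) is in the
  -- generated submodule: its vectors of weight `lam` lie in the graph of f, while f v ≠ 0 and f 0 =
  -- 0.
  refine nonempty_iso_of_isSubmodule_prod hM hN (hS.isSubmodule_lowerSpan htop hγ)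
    ⟨_, hSP (hmem v), fun h => ?_⟩ ⟨_, hSP (hmem v), fun h => ?_⟩
    ⟨v, fun h => ?_⟩ ⟨f v, fun h => ?_⟩
  · have h' : v = 0 := Subtype.ext h
    exact hv (by rw [h', map_zero])
  · exact hv (Subtype.ext h)
  · obtain ⟨u, hu⟩ := hinf ⟨h, fun k => Prod.ext (v.2 k) (by
      change N.act _ 0 = lam k • (0 : W)
      rw [map_zero, smul_zero])⟩
    obtain ⟨h1, h2⟩ := Prod.mk_inj.1 hu
    have h1' : u = v := Subtype.ext h1
    exact hv (Subtype.ext (h1' ▸ h2))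
  · obtain ⟨u, hu⟩ := hinf ⟨h, fun k => Prod.ext (by
      change M.act _ 0 = lam k • (0 : V)
      rw [map_zero, smul_zero]) ((f v).2 k)⟩
    obtain ⟨h1, h2⟩ := Prod.mk_inj.1 hu
    have h1' : u = 0 := Subtype.ext h1
    have h2' : f u = f v := Subtype.ext h2
    exact hv (by rw [← h2', h1', map_zero])

/-- The degree of the supercommuting map between the highest weight spaces decides between N and
Π(N). -/
theorem IsSimple.nonempty_iso_or_parityChange [FiniteDimensional F 𝔤] (hM : M.IsSimple)
    (hN : N.IsSimple) (hH : H.IsCartanSubalgebra)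
    (htop : ⨆ α, G.adjoint.weightSpace H α = ⊤) (hγ : ∀ α : roots H, γ (rootOf H α) ≠ 0)
    {lam : Module.Dual F H} (hlM : M.IsHighestWeight H γ lam)
    (hlN : N.IsHighestWeight H γ lam) :
    Nonempty (M.Iso N) ∨ Nonempty (M.Iso N.parityChange) := by
  have : Nontrivial (M.weightSpace H lam) := Submodule.nontrivial_iff_ne_bot.2 hlM.1
  have : Nontrivial (N.weightSpace H lam) := Submodule.nontrivial_iff_ne_bot.2 hlN.1
  have hscalar : ∀ a ∈ (cartan H).toLieSuperalgebra.part 0, ∃ c : F,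
      (∀ v, (M.weightModule H lam).act a v = c • v) ∧
      ∀ w, (N.weightModule H lam).act a w = c • w := by
    rintro ⟨a, ha⟩ ha0
    obtain ⟨h, rfl⟩ := exists_eq_of_mem_cartan hH ha ha0
    exact ⟨lam h, fun v => Subtype.ext (v.2 h), fun w => Subtype.ext (w.2 h)⟩
  obtain ⟨i, f, hf⟩ := exists_isOddInvariant (M.weightModule H lam) (N.weightModule H lam) hscalar
  fin_cases i
  · exact Or.inl (nonempty_iso_of_isHom_weightModule hM hN hH.nilpotent htop hγ hlM hlN
      hf.ne_zero (hf.isHom hscalar))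
  · obtain ⟨g, hg0, hg⟩ := hf.exists_isHom_parityChange hscalar
    -- Weight spaces do not see parity, so `hlN` serves unchanged for Π(N), and the weight module of
    -- Π(N) has the parts and action of Π applied to that of N.
    exact Or.inr (nonempty_iso_of_isHom_weightModule (N := N.parityChange) (f := g) hM
      hN.parityChange hH.nilpotent htop hγ hlM hlN hg0 ⟨hg.map_part, hg.map_act⟩)

end SuperModule

end Classification

theorem mainTheorem8 {F : Type*} [Field F] [IsAlgClosed F] [CharZero F]
    {𝔤 : Type*} [AddCommGroup 𝔤] [Module F 𝔤] [FiniteDimensional F 𝔤]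
    (G : LieSuperalgebra F 𝔤) (hG : G.IsQuasireductive)
    (H : LieSubalgebra F G.even) (hH : H.IsCartanSubalgebra)
    (γ : LieSuperalgebra.rootLattice H →+ ℝ)
    (hγ : ∀ α : LieSuperalgebra.roots H, γ (LieSuperalgebra.rootOf H α) ≠ 0)
    {V : Type*} [AddCommGroup V] [Module F V]
    (L : SuperModule G V) (hLF : L.InF) (hL : L.IsSimple) :
    (∃! lam : Module.Dual F H, L.IsHighestWeight H γ lam) ∧
    (∀ lam : Module.Dual F H, L.IsHighestWeight H γ lam → (L.weightModule H lam).IsSimple) ∧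
    (∀ {W : Type*} [AddCommGroup W] [Module F W] (M : SuperModule G W),
      M.InF → M.IsSimple →
      ∀ lam : Module.Dual F H, L.IsHighestWeight H γ lam → M.IsHighestWeight H γ lam →
        Nonempty (M.Iso L) ∨ Nonempty (M.Iso L.parityChange)) := by
  have htop := hG.iSup_rootSpace_eq_top H hH
  have := hLF.1
  obtain ⟨lam, hlam⟩ := hL.exists_isHighestWeight hH.nilpotent htop hγ
    (hG.iSup_weightSpace_eq_top H hH L hLF)
  exact ⟨⟨lam, hlam, fun μ hμ => hμ.eq hlam⟩,
    fun μ hμ => hμ.isSimple_weightModule hL hH.nilpotent htop hγ,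
    fun M _ hM μ hμ hμ' => hM.nonempty_iso_or_parityChange hL hH htop hγ hμ' hμ⟩
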